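/- Let $X$ be a metric space, $\mu$ a Borel probability measure on $X$, and $f\colon X\to X$ an invertible (bimeasurable) $\mu$-preserving transformation that is totally ergodic, i.e. $f^n$ is ergodic for every integer $n\ge1$. For $x\in X$ put $$W^{ss}(x)=\{y: d(f^n(x),f^n(y))\to0 \text{ as } n\to+\infty\},\qquad W^{su}(x)=\{y: d(f^{-n}(x),f^{-n}(y))\to0\text{ as } n\to+\infty\}.$$ A measurable set $V\subset X$ is an $(ss,su)$-product set if for $x\in V$ and $k\in\{ss,su\}$ there are local leaves $W^k_{\rm loc}(x)$ with $x\in W^k_{\rm loc}(x)\subset W^k(x)$ that partition $V$ (if $x,y\in V$ and $y\in W^k_{\rm loc}(x)$, then $W^k_{\rm loc}(y)\cap V=W^k_{\rm loc}(x)\cap V$), and a measurable map $[\cdot,\cdot]\colon V\times V\to X$ such that $W^{ss}_{\rm loc}(x)\cap W^{su}_{\rm loc}(y)=\{[x,y]\}$ for all $x,y\in V$. $W^{ss}$ is absolutely continuous on such a set $V$ if for each $x\in V$ there are measures $\mu^{ss}_x$ on $W^{ss}_{\rm loc}(x)$, carried by $W^{ss}_{\rm loc}(x)\cap V$, and $\mu^{su}_x$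 on $W^{su}_{\rm loc}(x)$ such that - for all $x,y\in V$ and $N\subset W^{su}_{\rm loc}(x)\cap V$, $\mu^{su}_x(N)=0$ implies $\mu^{su}_y([N,y])=0$, where $[N,y]=\{[n,y]:n\in N\}$; - for all $z\in V$ and $\varphi\in L^1(\mu)$, the iterated integral below exists and $$\int_V\varphi\,d\mu=\int_{W^{ss}_{\rm loc}(z)}\int_{W^{su}_{\rm loc}(x)}\varphi\,d\mu^{su}_x\,d\mu^{ss}_z(x).$$ Suppose that $W^{ss}$ is absolutely continuous on an $(ss,su)$-product set $V$ with $\mu(V)>0$. Then $f$ is multiply mixing: for every $N\in\mathbb N$ and all $\varphi_1,\dots,\varphi_N\in L^\infty(\mu)$, $$\prod_{i=1}^N\varphi_i\circ f^{\,n_1+\cdots+n_i}\longrightarrow\prod_{i=1}^N\int\varphi_i\,d\mu\quad\text{weakly in }L^2(\mu)\text{ as all } n_1,\dots,n_N\to\infty,$$ that is, for every $\psi\in L^2(\mu)$ and $\varepsilon>0$ there is a $K$ such that $\bigl|\int\psi\prod_{i}\varphi_i\circ f^{\,n_1+\cdots+n_i}\,d\mu-\prod_i\int\varphi_i\,d\mu\int\psi\,d\mu\bigr|<\varepsilon$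 whenever $n_i\ge K$ for all $i$. -/

import Mathlib

open MeasureTheory Filter Topology

namespace HopfMixing

/-- The stable set `W^{ss}(x)` of a map `f`. -/
def stableSet {X : Type*} [MetricSpace X] (f : X → X) (x : X) : Set X :=
  {y | Tendsto (fun n : ℕ => dist (f^[n] x) (f^[n] y)) atTop (𝓝 0)}

/-- The unstable set `W^{su}(x)` of an invertible map `f`. -/
def unstableSet {X : Type*} [MetricSpace X] [MeasurableSpace X] (f : X ≃ᵐ X) (x : X) : Set X :=
  stableSet f.symm x

/-- All positive powers of `f` are ergodic. -/
def IsTotallyErgodic {X : Type*} [MeasurableSpace X] (f : X → X) (μ : Measure X) : Prop :=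
  ∀ n : ℕ, 1 ≤ n → Ergodic f^[n] μ

/-- `N`-mixing: for bounded `φ₁, …, φ_N`, the products `∏ i, φ i ∘ f ^ (n 1 + ⋯ + n i)` converge
weakly in `L²` (that is, against every `ψ ∈ L²`) to the constant `∏ i, ∫ φ i`, as all the
gaps `n i` tend to infinity. -/
def IsNMixing {X : Type*} [MeasurableSpace X] (N : ℕ) (f : X → X) (μ : Measure X) : Prop :=
  ∀ φ : Fin N → X → ℝ, (∀ i, MemLp (φ i) ⊤ μ) → ∀ ψ : X → ℝ, MemLp ψ 2 μ →
    Tendsto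
      (fun n : Fin N → ℕ => ∫ x, (∏ i, φ i (f^[∑ j ∈ Finset.Iic i, n j] x)) * ψ x ∂μ)
      atTop (𝓝 (∫ x, (∏ i, ∫ t, φ i t ∂μ) * ψ x ∂μ))

/-- Multiple mixing: `N`-mixing for all `N`. -/
def IsMultiplyMixing {X : Type*} [MeasurableSpace X] (f : X → X) (μ : Measure X) : Prop :=
  ∀ N : ℕ, IsNMixing N f μ

/-- `Li x`, for `x ∈ V`, are local leaves of the partition `Wi`: subsets of the sets `Wi x`,
containing `x`, that cut `V` into pairwise disjoint pieces. Values of `Li` off `V` are irrelevant;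
`Li x` need not be contained in `V`. -/
structure IsLocalLeaves {X : Type*} (Wi : X → Set X) (V : Set X) (Li : X → Set X) : Prop where
  subset : ∀ x ∈ V, Li x ⊆ Wi x
  mem_self : ∀ x ∈ V, x ∈ Li x
  coherent : ∀ x ∈ V, ∀ y ∈ V, y ∈ Li x → Li y ∩ V = Li x ∩ V

/-- `V` is a product set for the pair of partitions `Wi`, `Wj`, with local leaves `Li x`, `Lj x`
and bracket `br x y`, the point of intersection of `Li x` and `Lj y`. The bracket is
measurable on `V × V`, with values in `X`. -/
structure IsProductSet {X : Type*} [MeasurableSpace X] (Wi Wj : X → Set X) (V : Set X)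
    (Li Lj : X → Set X) (br : X → X → X) : Prop where
  measurableSet : MeasurableSet V
  left : IsLocalLeaves Wi V Li
  right : IsLocalLeaves Wj V Lj
  inter_eq : ∀ x ∈ V, ∀ y ∈ V, Li x ∩ Lj y = {br x y}
  measurable_br : Measurable (fun p : V × V => br p.1 p.2)

/-- Absolute continuity of the partition with local leaves `Li` on a product set `V`:
there are measures `mi x` on `Li x` and `mj x` on `Lj x` for `x ∈ V` such that
the holonomies `n ↦ br n y` between the leaves `Lj x` and `Lj y` send null sets to null sets, and
`μ` on `V` is the iterated integral of the measures `mj x` with respect to `mi z`.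
A measure on a subset of `X` is regarded as a measure on `X` vanishing off that subset; `mi z` is
carried by `V`, since the inner integrals are over the leaves `Lj x` with `x ∈ V`. -/
def IsAbsolutelyContinuousOn {X : Type*} [MeasurableSpace X] (μ : Measure X) (V : Set X)
    (Li Lj : X → Set X) (br : X → X → X) : Prop :=
  ∃ mi mj : X → Measure X,
    (∀ z ∈ V, mi z (Li z ∩ V)ᶜ = 0) ∧
    (∀ x ∈ V, mj x (Lj x)ᶜ = 0) ∧
    (∀ x ∈ V, ∀ y ∈ V, ∀ N : Set X, N ⊆ Lj x ∩ V → mj x N = 0 →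
      mj y ((fun n => br n y) '' N) = 0) ∧
    (∀ z ∈ V, ∀ φ : X → ℝ, Integrable φ μ →
      (∀ᵐ x ∂(mi z), Integrable φ (mj x)) ∧
      Integrable (fun x => ∫ y, φ y ∂(mj x)) (mi z) ∧
      ∫ y in V, φ y ∂μ = ∫ x, ∫ y, φ y ∂(mj x) ∂(mi z))

end HopfMixing

/-! The proof is a Hopf argument in `L²`, where weak limits replace Birkhoff averages. The key fact
(`IsAsympInvariant.not_forall_le`) is of Mazur type: if bounded functions satisfy `g k x - g k y →
0` for related points `x`, `y` of a full-measure set, then convex combinations of far tails that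
converge in `L²` have an invariant limit. Hence such a family is weakly null against everything
orthogonal to the invariant functions. Uniform `L²` approximation by uniformly continuous functions
extends this to the compositions of any bounded function with iterates of `f`: towards `+∞` for the
stable relation, towards `-∞` for the unstable one.

For multiple correlations at times `t 0 < ⋯ < t N`, start from the latest function and replace each
in turn, the first excepted, by its conditional expectation on the unstably invariant sets. Seen
from the time of the function being replaced, earlier factors lie far in the past and later ones are
already unstably invariant, so the product of the others is approximately unstably invariant and the
replacement costs nothing in the limit. In the end, the product of all factors but the first, seen
from `t 0`, is approximately invariant for both relations. If only constants are invariant under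
both, the first function may be replaced by its mean, and induction on the number of functions
finishes (`tendsto_integral_prod_zIterate`).

It remains to see that a doubly invariant function `h` is constant. Absolute continuity makes it
constant on `V` (`exists_ae_eq_const_on_productSet`). The same holds for every `h ∘ f^n`, and for
some `p ≥ 1` the set `V` meets `f^{-p} V` in positive measure, which forces `h ∘ f^p = h` first on
`V`, then along almost every orbit. Ergodicity of `f^p` concludes (`exists_ae_eq_const`). -/

namespace HopfMixing

/-! ### Almost minimal points of convex sets -/

/-- In a Hilbert space, almost minimal points of a decreasing sequence of nonempty bounded convex
sets converge. -/
theorem exists_mem_tendsto_of_antitone_convex {H : Type*} [NormedAddCommGroup H]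
    [InnerProductSpace ℝ H] [CompleteSpace H] {C : ℕ → Set H} (hanti : Antitone C)
    (hconv : ∀ n, Convex ℝ (C n)) (hne : ∀ n, (C n).Nonempty) {R : ℝ}
    (hR : ∀ n, ∀ x ∈ C n, ‖x‖ ≤ R) :
    ∃ h : ℕ → H, (∀ n, h n ∈ C n) ∧ ∃ a, Tendsto h atTop (𝓝 a) := by
  set S : ℕ → Set ℝ := fun n => (fun x : H => ‖x‖ ^ 2) '' C n with hS
  have hSne : ∀ n, (S n).Nonempty := fun n => (hne n).image _
  have hSbdd : ∀ n, BddBelow (S n) := fun n => ⟨0, by rintro _ ⟨x, -, rfl⟩; positivity⟩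
  set d : ℕ → ℝ := fun n => sInf (S n) with hd
  have hmono : Monotone d := fun m n hmn =>
    csInf_le_csInf (hSbdd m) (hSne n) (Set.image_mono (hanti hmn))
  have hle : ∀ n, ∀ x ∈ C n, d n ≤ ‖x‖ ^ 2 := fun n x hx =>
    csInf_le (hSbdd n) ⟨x, hx, rfl⟩
  have hbdd : BddAbove (Set.range d) := by
    refine ⟨R ^ 2, ?_⟩
    rintro _ ⟨n, rfl⟩
    obtain ⟨x, hx⟩ := hne n
    exact (hle n x hx).trans (pow_le_pow_left₀ (norm_nonneg _) (hR n x hx) 2)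
  have hlim := tendsto_atTop_ciSup hmono hbdd
  set D := ⨆ n, d n
  have hdD : ∀ n, d n ≤ D := fun n => le_ciSup hbdd n
  have hex : ∀ n : ℕ, ∃ x ∈ C n, ‖x‖ ^ 2 < d n + 1 / ((n : ℝ) + 1) := by
    intro n
    obtain ⟨_, ⟨x, hx, rfl⟩, hlt⟩ := exists_lt_of_csInf_lt (hSne n)
      (show sInf (S n) < d n + 1 / ((n : ℝ) + 1) by
        have : (0 : ℝ) < 1 / ((n : ℝ) + 1) := by positivity
        simp only [hd]; linarith)
    exact ⟨x, hx, hlt⟩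
  choose h hmem hlt using hex
  refine ⟨h, hmem, ?_⟩
  have hcauchy : CauchySeq h := by
    -- The midpoint of `h n` and `h m` lies in `C n`, so its squared norm is at least `d n`. The
    -- parallelogram law then gives `‖h n - h m‖² ≤ 2 (d m - d n) + 4 / (n + 1)`, and `d m ≤ D`.
    refine cauchySeq_of_le_tendsto_0' (fun n : ℕ => √(2 * (D - d n) + 4 * (1 / ((n : ℝ) + 1))))
      ?_ ?_
    · intro n m hnm
      have hmid : (2⁻¹ : ℝ) • h n + (2⁻¹ : ℝ) • h m ∈ C n :=
        hconv n (hmem n) (hanti hnm (hmem m)) (by norm_num) (by norm_num) (by norm_num)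
      have h1 := hle n _ hmid
      rw [← smul_add, norm_smul, mul_pow] at h1
      have h2 := parallelogram_law_with_norm ℝ (h n) (h m)
      have h3 : 1 / ((m : ℝ) + 1) ≤ 1 / ((n : ℝ) + 1) := by gcongr
      have h4 := hlt n
      have h5 := hlt m
      have h6 := hdD m
      rw [dist_eq_norm]
      apply Real.le_sqrt_of_sq_le
      norm_num at h1
      linarith
    · have h1 : Tendsto (fun n : ℕ => 2 * (D - d n) + 4 * (1 / ((n : ℝ) + 1))) atTop
          (𝓝 (2 * (D - D) + 4 * 0)) :=
        ((tendsto_const_nhds.sub hlim).const_mul 2).add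
          (tendsto_one_div_add_atTop_nhds_zero_nat.const_mul 4)
      have h2 := (Real.continuous_sqrt.tendsto _).comp h1
      simpa [Function.comp_def] using h2
  exact cauchySeq_tendsto_of_complete hcauchy

theorem abs_convexComb_le {a b p q C : ℝ} (ha : 0 ≤ a) (hb : 0 ≤ b) (hab : a + b = 1)
    (hp : |p| ≤ C) (hq : |q| ≤ C) : |a * p + b * q| ≤ C := by
  rw [abs_le] at hp hq ⊢
  obtain rfl : b = 1 - a := by linarith
  constructor <;> nlinarith

/-! ### Invariant, asymptotically invariant and approximately invariant functions -/

/-- A real function which is measurable and bounded. -/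
def IsBddMeasurable {X : Type*} [MeasurableSpace X] (g : X → ℝ) : Prop :=
  Measurable g ∧ ∃ C, ∀ x, |g x| ≤ C

/-- The `σ`-algebra of measurable sets which are saturated, up to a null set, for the
relation `W`. -/
@[reducible]
def invariantSpace {X : Type*} [MeasurableSpace X] (W : X → X → Prop) (μ : Measure X) :
    MeasurableSpace X where
  MeasurableSet' A := MeasurableSet A ∧ ∃ E : Set X, (∀ᵐ x ∂μ, x ∈ E) ∧
    ∀ x ∈ E, ∀ y ∈ E, W x y → (x ∈ A ↔ y ∈ A)
  measurableSet_empty := ⟨.empty, Set.univ, by simp, by simp⟩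
  measurableSet_compl := by
    rintro A ⟨hA, E, hE, h⟩
    exact ⟨hA.compl, E, hE, fun x hx y hy hxy => not_congr (h x hx y hy hxy)⟩
  measurableSet_iUnion := by
    intro A hA
    choose hm E hE h using hA
    refine ⟨.iUnion hm, ⋂ n, E n, by simpa [ae_all_iff] using hE, fun x hx y hy hxy => ?_⟩
    simp only [Set.mem_iInter] at hx hy
    simp only [Set.mem_iUnion]
    exact exists_congr fun n => h n x (hx n) y (hy n) hxy

/-- `h` is invariant under the relation `W` on a set of full measure. -/
def IsAEInvariant {X : Type*} [MeasurableSpace X] (W : X → X → Prop) (μ : Measure X)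
    (h : X → ℝ) : Prop :=
  ∃ E : Set X, (∀ᵐ x ∂μ, x ∈ E) ∧ ∀ x ∈ E, ∀ y ∈ E, W x y → h x = h y

/-- A bounded family of functions which is asymptotically invariant under the relation `W` on a
set of full measure. -/
def IsAsympInvariant {X ι : Type*} [MeasurableSpace X] (W : X → X → Prop) (μ : Measure X)
    (l : Filter ι) (g : ι → X → ℝ) : Prop :=
  (∃ C, ∀ k x, |g k x| ≤ C) ∧ (∀ k, Measurable (g k)) ∧
    ∃ E : Set X, (∀ᵐ x ∂μ, x ∈ E) ∧
      ∀ x ∈ E, ∀ y ∈ E, W x y → Tendsto (fun k => g k x - g k y) l (𝓝 0)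

/-- A bounded family of functions which is uniformly approximated in `L²` by asymptotically
invariant families. -/
def IsApproxInvariant {X ι : Type*} [MeasurableSpace X] (W : X → X → Prop) (μ : Measure X)
    (l : Filter ι) (g : ι → X → ℝ) : Prop :=
  (∃ C, ∀ k x, |g k x| ≤ C) ∧ (∀ k, Measurable (g k)) ∧
    ∀ ε : ENNReal, ε ≠ 0 → ∃ g' : ι → X → ℝ, IsAsympInvariant W μ l g' ∧
      ∀ k, eLpNorm (g k - g' k) 2 μ ≤ ε

section

variable {X ι : Type*} [MeasurableSpace X] {W : X → X → Prop} {μ : Measure X} {l : Filter ι}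

theorem invariantSpace_le : invariantSpace W μ ≤ ‹MeasurableSpace X› := fun _ h => h.1

theorem IsAEInvariant.measurable {h : X → ℝ} (hi : IsAEInvariant W μ h) (hm : Measurable h) :
    Measurable[invariantSpace W μ] h := by
  obtain ⟨E, hE, hi⟩ := hi
  intro B hB
  exact ⟨hm hB, E, hE, fun x hx y hy hxy => by simp [hi x hx y hy hxy]⟩

/-- The rational sublevel sets separate the values of `h` and are countably many, so their
exceptional sets merge into a single null set. -/
theorem isAEInvariant_of_measurable {h : X → ℝ} (hm : Measurable[invariantSpace W μ] h) :
    IsAEInvariant W μ h := by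
  have H : ∀ q : ℚ, MeasurableSet[invariantSpace W μ] (h ⁻¹' Set.Iio (q : ℝ)) :=
    fun q => hm measurableSet_Iio
  choose _ E hE hi using H
  refine ⟨⋂ q, E q, by simpa [ae_all_iff] using hE, fun x hx y hy hxy => ?_⟩
  simp only [Set.mem_iInter] at hx hy
  by_contra hne
  rcases lt_or_gt_of_ne hne with hlt | hlt
  · obtain ⟨q, h1, h2⟩ := exists_rat_btwn hlt
    have := (hi q x (hx q) y (hy q) hxy).1 h1
    exact lt_asymm h2 this
  · obtain ⟨q, h1, h2⟩ := exists_rat_btwn hlt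
    have := (hi q x (hx q) y (hy q) hxy).2 h1
    exact lt_asymm h2 this

theorem IsAEInvariant.congr {h h' : X → ℝ} (hi : IsAEInvariant W μ h) (hh : h =ᵐ[μ] h') :
    IsAEInvariant W μ h' := by
  obtain ⟨E, hE, hi⟩ := hi
  refine ⟨E ∩ {x | h x = h' x}, by filter_upwards [hE, hh] with x h1 h2 using ⟨h1, h2⟩, ?_⟩
  rintro x ⟨hx, hx'⟩ y ⟨hy, hy'⟩ hxy
  rw [← hx', ← hy', hi x hx y hy hxy]

theorem aestronglyMeasurable_invariantSpace_iff {h : X → ℝ} (hm : Measurable h) :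
    AEStronglyMeasurable[invariantSpace W μ] h μ ↔ IsAEInvariant W μ h := by
  constructor
  · rintro ⟨h', hm', hh⟩
    exact (isAEInvariant_of_measurable hm'.measurable).congr hh.symm
  · exact fun hi => (hi.measurable hm).stronglyMeasurable.aestronglyMeasurable

theorem IsAsympInvariant.comp {κ : Type*} {l' : Filter κ} {g : ι → X → ℝ} {n : κ → ι}
    (hg : IsAsympInvariant W μ l g) (hn : Tendsto n l' l) :
    IsAsympInvariant W μ l' (fun k => g (n k)) := by
  obtain ⟨⟨C, hC⟩, hm, E, hE, h⟩ := hg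
  exact ⟨⟨C, fun k => hC (n k)⟩, fun k => hm (n k), E, hE,
    fun x hx y hy hxy => (h x hx y hy hxy).comp hn⟩

theorem IsAsympInvariant.neg {g : ι → X → ℝ} (hg : IsAsympInvariant W μ l g) :
    IsAsympInvariant W μ l (fun k => -g k) := by
  obtain ⟨⟨C, hC⟩, hm, E, hE, h⟩ := hg
  refine ⟨⟨C, fun k x => by simpa using hC k x⟩, fun k => (hm k).neg, E, hE,
    fun x hx y hy hxy => ?_⟩
  have := (h x hx y hy hxy).neg
  simp only [neg_zero] at this
  refine this.congr fun k => ?_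
  simp only [Pi.neg_apply]; ring

theorem memLp_of_bound [IsFiniteMeasure μ] {g : X → ℝ} (hm : Measurable g) {C : ℝ}
    (hC : ∀ x, |g x| ≤ C) {p : ENNReal} : MemLp g p μ :=
  MemLp.of_bound hm.aestronglyMeasurable C (ae_of_all _ hC)

theorem IsBddMeasurable.memLp [IsFiniteMeasure μ] {g : X → ℝ} (hg : IsBddMeasurable g)
    {p : ENNReal} : MemLp g p μ :=
  memLp_of_bound hg.1 hg.2.choose_spec

theorem integrable_lp_mul [IsFiniteMeasure μ] (F : Lp ℝ 2 μ) {g : X → ℝ} (hm : Measurable g)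
    {C : ℝ} (hC : ∀ x, |g x| ≤ C) : Integrable (fun x => F x * g x) μ :=
  MemLp.integrable_mul (p := 2) (q := 2) (Lp.memLp F) (memLp_of_bound hm hC)

/-- A sequence which is asymptotically invariant cannot have integrals bounded away from zero
against a function orthogonal to the invariant functions. -/
theorem IsAsympInvariant.not_forall_le [IsProbabilityMeasure μ] {g : ℕ → X → ℝ}
    (hg : IsAsympInvariant W μ atTop g) {F : Lp ℝ 2 μ}
    (hF : F ∈ (lpMeas ℝ ℝ (invariantSpace W μ) 2 μ)ᗮ) {δ : ℝ} (hδ : 0 < δ) :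
    ¬ ∀ k, δ ≤ ∫ x, F x * g k x ∂μ := by
  intro hle
  obtain ⟨⟨C, hC⟩, hm, E, hE, hW⟩ := hg
  -- Measurability, the uniform bound and the lower bound on the integral are convex conditions, so
  -- they pass from the tail to its convex hull.
  have hgood : ∀ K, ∀ u ∈ convexHull ℝ (g '' Set.Ici K),
      Measurable u ∧ (∀ x, |u x| ≤ C) ∧ δ ≤ ∫ x, F x * u x ∂μ := by
    intro K
    have : convexHull ℝ (g '' Set.Ici K) ⊆
        {u | Measurable u ∧ (∀ x, |u x| ≤ C) ∧ δ ≤ ∫ x, F x * u x ∂μ} := by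
      refine convexHull_min ?_ ?_
      · rintro _ ⟨k, -, rfl⟩
        exact ⟨hm k, hC k, hle k⟩
      · rintro u ⟨hu, hu', hu''⟩ v ⟨hv, hv', hv''⟩ a b ha hb hab
        refine ⟨(hu.const_smul a).add (hv.const_smul b), fun x => ?_, ?_⟩
        · exact abs_convexComb_le ha hb hab (hu' x) (hv' x)
        · have h1 : ∫ x, F x * (a • u + b • v) x ∂μ
              = a * (∫ x, F x * u x ∂μ) + b * ∫ x, F x * v x ∂μ := by
            rw [← integral_const_mul, ← integral_const_mul, ← integral_add
              ((integrable_lp_mul F hu hu').const_mul a) ((integrable_lp_mul F hv hv').const_mul b)]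
            congr 1 with x
            simp only [Pi.add_apply, Pi.smul_apply, smul_eq_mul]
            ring
          rw [h1]
          obtain rfl : b = 1 - a := by linarith
          nlinarith
    exact this
  -- A bound on the oscillation between two fixed points is convex too; this carries asymptotic
  -- invariance to convex combinations of tails.
  have hosc : ∀ K, ∀ η : ℝ, ∀ x y, (∀ k ≥ K, |g k x - g k y| ≤ η) →
      ∀ u ∈ convexHull ℝ (g '' Set.Ici K), |u x - u y| ≤ η := by
    intro K η x y hk
    have : convexHull ℝ (g '' Set.Ici K) ⊆ {u | |u x - u y| ≤ η} := by
      refine convexHull_min ?_ ?_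
      · rintro _ ⟨k, hkK, rfl⟩
        exact hk k hkK
      · intro u hu v hv a b ha hb hab
        simp only [Set.mem_ofPred_eq, Pi.add_apply, Pi.smul_apply, smul_eq_mul] at hu hv ⊢
        rw [show a * u x + b * v x - (a * u y + b * v y)
          = a * (u x - u y) + b * (v x - v y) by ring]
        exact abs_convexComb_le ha hb hab hu hv
    exact this
  set S : ℕ → Set (Lp ℝ 2 μ) := fun K =>
    {G | ∃ u ∈ convexHull ℝ (g '' Set.Ici K), G =ᵐ[μ] u} with hS
  obtain ⟨h, hh, a, ha⟩ := exists_mem_tendsto_of_antitone_convex (C := S) (R := C)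
    (by
      rintro m n hmn G ⟨u, hu, hG⟩
      exact ⟨u, convexHull_mono (Set.image_mono (Set.Ici_subset_Ici.2 hmn)) hu, hG⟩)
    (by
      rintro K G ⟨u, hu, hG⟩ G' ⟨u', hu', hG'⟩ a b ha hb hab
      refine ⟨a • u + b • u', convex_convexHull ℝ _ hu hu' ha hb hab, ?_⟩
      filter_upwards [Lp.coeFn_add (a • G) (b • G'), Lp.coeFn_smul a G, Lp.coeFn_smul b G',
        hG, hG'] with x h1 h2 h3 h4 h5
      rw [h1, Pi.add_apply, h2, h3]
      simp [h4, h5])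
    (by
      intro K
      have hK := subset_convexHull ℝ _ (Set.mem_image_of_mem g (Set.self_mem_Ici (a := K)))
      exact ⟨(memLp_of_bound (hm K) (hC K)).toLp _, g K, hK, MemLp.coeFn_toLp _⟩)
    (by
      rintro K G ⟨u, hu, hG⟩
      have h0 : 0 ≤ C := by
        obtain ⟨x⟩ : Nonempty X := μ.nonempty_of_neZero
        exact (abs_nonneg _).trans (hC 0 x)
      have := Lp.norm_le_of_ae_bound (f := G) h0 (by
        filter_upwards [hG] with x hx
        rw [hx]; exact (hgood K u hu).2.1 x)
      simpa [measureUnivNNReal] using this)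
  choose u hu hhu using hh
  -- Invariance is a pointwise notion, so a subsequence converging almost everywhere is needed; a
  -- merely weak limit would not suffice.
  obtain ⟨ns, hns, hlim⟩ := (tendstoInMeasure_of_tendsto_Lp ha).exists_seq_tendsto_ae
  have hlim' : ∀ᵐ x ∂μ, Tendsto (fun i => u (ns i) x) atTop (𝓝 (a x)) := by
    filter_upwards [hlim, ae_all_iff.2 hhu] with x h1 h2
    simpa only [h2] using h1
  have hinv : IsAEInvariant W μ a := by
    refine ⟨E ∩ {x | Tendsto (fun i => u (ns i) x) atTop (𝓝 (a x))}, ?_, ?_⟩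
    · filter_upwards [hE, hlim'] with x h1 h2 using ⟨h1, h2⟩
    · rintro x ⟨hx, hx'⟩ y ⟨hy, hy'⟩ hxy
      have h0 : Tendsto (fun i => u (ns i) x - u (ns i) y) atTop (𝓝 0) := by
        rw [Metric.tendsto_atTop]
        intro ε hε
        obtain ⟨K, hK⟩ := Metric.tendsto_atTop.1 (hW x hx y hy hxy) (ε / 2) (by positivity)
        refine ⟨K, fun i hi => ?_⟩
        have hKi : K ≤ ns i := hi.trans (hns.id_le i)
        have := hosc (ns i) (ε / 2) x y (fun k hk => by
          have := hK k (hKi.trans hk)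
          rw [Real.dist_eq, sub_zero] at this
          exact this.le) _ (hu (ns i))
        rw [Real.dist_eq, sub_zero]
        linarith
      have := tendsto_nhds_unique h0 (Tendsto.sub hx' hy')
      linarith
  have hmem : a ∈ lpMeas ℝ ℝ (invariantSpace W μ) 2 μ := by
    rw [mem_lpMeas_iff_aestronglyMeasurable]
    exact (aestronglyMeasurable_invariantSpace_iff (Lp.stronglyMeasurable a).measurable).2 hinv
  have hin : Tendsto (fun n => inner ℝ F (h n)) atTop (𝓝 (inner ℝ F a)) :=
    tendsto_const_nhds.inner ha
  have hzero : inner ℝ F a = 0 := by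
    rw [real_inner_comm]; exact hF a hmem
  rw [hzero] at hin
  have hge : ∀ n, δ ≤ inner ℝ F (h n) := by
    intro n
    rw [L2.inner_def]
    refine ((hgood n _ (hu n)).2.2).trans (le_of_eq (integral_congr_ae ?_))
    filter_upwards [hhu n] with x hx
    rw [hx]
    simp [mul_comm]
  exact absurd (ge_of_tendsto' hin hge) (not_le.2 hδ)

/-- If convergence failed, the integrals of `g` or of `-g` would stay above some `ε > 0` along a
sequence tending to `l`, which exists because `l` is countably generated. That sequence is still
asymptotically invariant. -/
theorem IsAsympInvariant.tendsto_integral_mul [IsProbabilityMeasure μ] [l.IsCountablyGenerated]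
    {g : ι → X → ℝ} (hg : IsAsympInvariant W μ l g) {F : Lp ℝ 2 μ}
    (hF : F ∈ (lpMeas ℝ ℝ (invariantSpace W μ) 2 μ)ᗮ) :
    Tendsto (fun k => ∫ x, F x * g k x ∂μ) l (𝓝 0) := by
  have key : ∀ g : ι → X → ℝ, IsAsympInvariant W μ l g → ∀ ε > 0,
      ∀ᶠ k in l, ∫ x, F x * g k x ∂μ < ε := by
    intro g hg ε hε
    by_contra hcon
    rw [not_eventually] at hcon
    obtain ⟨ns, hns, hle⟩ := exists_seq_forall_of_frequently hcon
    exact (hg.comp hns).not_forall_le hF hε fun k => not_lt.1 (hle k)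
  rw [Metric.tendsto_nhds]
  intro ε hε
  filter_upwards [key g hg ε hε, key _ hg.neg ε hε] with k h1 h2
  simp only [Pi.neg_apply, mul_neg, integral_neg] at h2
  rw [Real.dist_eq, sub_zero, abs_lt]
  constructor <;> linarith

theorem abs_integral_lp_mul_le (F : Lp ℝ 2 μ) {u : X → ℝ} (hu : MemLp u 2 μ) :
    |∫ x, F x * u x ∂μ| ≤ ‖F‖ * (eLpNorm u 2 μ).toReal := by
  have h := abs_real_inner_le_norm F (hu.toLp u)
  rw [Lp.norm_toLp, L2.inner_def] at h
  refine le_of_eq_of_le (congrArg _ (integral_congr_ae ?_)) h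
  filter_upwards [hu.coeFn_toLp] with x hx
  simp [hx, mul_comm]

/-- By Cauchy–Schwarz the approximation error contributes at most `‖F‖` times its `L²` norm,
uniformly in the index. -/
theorem IsApproxInvariant.tendsto_integral_mul [IsProbabilityMeasure μ] [l.IsCountablyGenerated]
    {g : ι → X → ℝ} (hg : IsApproxInvariant W μ l g) {F : Lp ℝ 2 μ}
    (hF : F ∈ (lpMeas ℝ ℝ (invariantSpace W μ) 2 μ)ᗮ) :
    Tendsto (fun k => ∫ x, F x * g k x ∂μ) l (𝓝 0) := by
  obtain ⟨⟨C, hC⟩, hm, happ⟩ := hg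
  rw [Metric.tendsto_nhds]
  intro ε hε
  have hη : 0 < ε / (2 * (‖F‖ + 1)) := by positivity
  obtain ⟨g', hg', hgg'⟩ := happ (ENNReal.ofReal (ε / (2 * (‖F‖ + 1)))) (by simpa using hη)
  filter_upwards [Metric.tendsto_nhds.1 (hg'.tendsto_integral_mul hF) (ε / 2) (by positivity)]
    with k hk
  obtain ⟨⟨C', hC'⟩, hm', -⟩ := hg'
  have h1 := abs_integral_lp_mul_le F
    ((memLp_of_bound (hm k) (hC k)).sub (memLp_of_bound (p := 2) (μ := μ) (hm' k) (hC' k)))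
  have h2 : (eLpNorm (g k - g' k) 2 μ).toReal ≤ ε / (2 * (‖F‖ + 1)) :=
    ENNReal.toReal_le_of_le_ofReal hη.le (hgg' k)
  have h3 : ‖F‖ * (eLpNorm (g k - g' k) 2 μ).toReal ≤ ε / 2 := by
    calc ‖F‖ * (eLpNorm (g k - g' k) 2 μ).toReal
        ≤ (‖F‖ + 1) * (ε / (2 * (‖F‖ + 1))) := by gcongr; linarith
      _ = ε / 2 := by field_simp
  have h4 : ∫ x, F x * (g k - g' k) x ∂μ
      = (∫ x, F x * g k x ∂μ) - ∫ x, F x * g' k x ∂μ := by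
    rw [← integral_sub (integrable_lp_mul F (hm k) (hC k)) (integrable_lp_mul F (hm' k) (hC' k))]
    congr 1 with x
    simp only [Pi.sub_apply]; ring
  rw [h4] at h1
  rw [Real.dist_eq, sub_zero] at hk ⊢
  have h5 := abs_add_le ((∫ x, F x * g k x ∂μ) - ∫ x, F x * g' k x ∂μ) (∫ x, F x * g' k x ∂μ)
  rw [sub_add_cancel] at h5
  linarith

theorem IsAsympInvariant.approx {g : ι → X → ℝ} (hg : IsAsympInvariant W μ l g) :
    IsApproxInvariant W μ l g :=
  ⟨hg.1, hg.2.1, fun _ _ => ⟨g, hg, fun k => by simp⟩⟩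

theorem IsAsympInvariant.mul {g h : ι → X → ℝ} (hg : IsAsympInvariant W μ l g)
    (hh : IsAsympInvariant W μ l h) : IsAsympInvariant W μ l (fun k => g k * h k) := by
  obtain ⟨⟨C, hC⟩, hm, E, hE, hW⟩ := hg
  obtain ⟨⟨D, hD⟩, hm', E', hE', hW'⟩ := hh
  refine ⟨⟨C * D, fun k x => ?_⟩, fun k => (hm k).mul (hm' k), E ∩ E', ?_, ?_⟩
  · simp only [Pi.mul_apply, abs_mul]
    exact mul_le_mul (hC k x) (hD k x) (abs_nonneg _) ((abs_nonneg _).trans (hC k x))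
  · filter_upwards [hE, hE'] with x h1 h2 using ⟨h1, h2⟩
  · rintro x ⟨hx, hx'⟩ y ⟨hy, hy'⟩ hxy
    have h1 : Tendsto (fun k => (g k x - g k y) * h k x) l (𝓝 0) :=
      (hW x hx y hy hxy).zero_mul_isBoundedUnder_le
        (isBoundedUnder_of ⟨D, fun k => by simpa using hD k x⟩)
    have h2 : Tendsto (fun k => (h k x - h k y) * g k y) l (𝓝 0) :=
      (hW' x hx' y hy' hxy).zero_mul_isBoundedUnder_le
        (isBoundedUnder_of ⟨C, fun k => by simpa using hC k y⟩)
    have := h1.add h2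
    rw [add_zero] at this
    refine this.congr fun k => ?_
    simp only [Pi.mul_apply]; ring

theorem eLpNorm_mul_le_of_bound {u v : X → ℝ} {C : ℝ} (hC : ∀ x, |v x| ≤ C) :
    eLpNorm (u * v) 2 μ ≤ ENNReal.ofReal C * eLpNorm u 2 μ := by
  refine eLpNorm_le_mul_eLpNorm_of_ae_le_mul (ae_of_all _ fun x => ?_) 2
  rw [Pi.mul_apply, norm_mul, mul_comm]
  exact mul_le_mul_of_nonneg_right (hC x) (norm_nonneg _)

/-- `L²` closeness survives multiplication because all the families are uniformly bounded. -/
theorem IsApproxInvariant.mul {g h : ι → X → ℝ} (hg : IsApproxInvariant W μ l g)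
    (hh : IsApproxInvariant W μ l h) : IsApproxInvariant W μ l (fun k => g k * h k) := by
  obtain ⟨⟨C, hC⟩, hm, hg⟩ := hg
  obtain ⟨⟨D, hD⟩, hm', hh⟩ := hh
  refine ⟨⟨C * D, fun k x => ?_⟩, fun k => (hm k).mul (hm' k), fun ε hε => ?_⟩
  · simp only [Pi.mul_apply, abs_mul]
    exact mul_le_mul (hC k x) (hD k x) (abs_nonneg _) ((abs_nonneg _).trans (hC k x))
  · have hsmall : ∀ c : ℝ, ∃ η : ENNReal, η ≠ 0 ∧ ENNReal.ofReal c * η ≤ ε / 2 := by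
      intro c
      refine ⟨ε / 2 / (ENNReal.ofReal c + 1), ?_, ?_⟩
      · exact (ENNReal.div_pos (ENNReal.half_pos hε).ne' (by simp)).ne'
      · calc ENNReal.ofReal c * (ε / 2 / (ENNReal.ofReal c + 1))
            ≤ (ENNReal.ofReal c + 1) * (ε / 2 / (ENNReal.ofReal c + 1)) := by
              gcongr; exact le_self_add
          _ ≤ ε / 2 := ENNReal.mul_div_le
    -- The order of choices matters: `g h - g' h' = (g - g') h + (h - h') g'`, and the bound `C'` of
    -- `g'` is known only once `g'` is chosen, so the tolerance for `h` comes second.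
    obtain ⟨η, hη, hη'⟩ := hsmall D
    obtain ⟨g', hg', hgg'⟩ := hg η hη
    obtain ⟨C', hC'⟩ := hg'.1
    obtain ⟨θ, hθ, hθ'⟩ := hsmall C'
    obtain ⟨h', hh', hhh'⟩ := hh θ hθ
    refine ⟨_, hg'.mul hh', fun k => ?_⟩
    have h1 : g k * h k - g' k * h' k = (g k - g' k) * h k + (h k - h' k) * g' k := by ring
    rw [h1]
    have hmg := hg'.2.1 k
    have hmh := hh'.2.1 k
    refine (eLpNorm_add_le (((hm k).sub hmg).mul (hm' k)).aestronglyMeasurable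
      (((hm' k).sub hmh).mul hmg).aestronglyMeasurable (by norm_num)).trans ?_
    rw [← ENNReal.add_halves ε]
    refine add_le_add ?_ ?_
    · refine (eLpNorm_mul_le_of_bound (hD k)).trans (le_trans ?_ hη')
      gcongr; exact hgg' k
    · refine (eLpNorm_mul_le_of_bound (hC' k)).trans (le_trans ?_ hθ')
      gcongr; exact hhh' k

theorem IsApproxInvariant.prod {κ : Type*} {g : κ → ι → X → ℝ} (s : Finset κ)
    (hg : ∀ j ∈ s, IsApproxInvariant W μ l (g j)) :
    IsApproxInvariant W μ l (fun k => ∏ j ∈ s, g j k) := by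
  classical
  induction s using Finset.induction_on with
  | empty =>
    refine IsAsympInvariant.approx ⟨⟨1, by simp⟩, fun k => ?_, Set.univ, by simp, ?_⟩
    · simpa using measurable_one
    · simpa using fun _ _ _ => tendsto_const_nhds
  | insert a s ha ih =>
    simp only [Finset.prod_insert ha]
    exact (hg a (by simp)).mul (ih fun j hj => hg j (by simp [hj]))

end

/-! ### Weak convergence to zero and orthogonality -/

section

variable {X ι : Type*} [MeasurableSpace X] {W : X → X → Prop} {μ : Measure X} {l : Filter ι}

/-- The functions in `L²` against which the integrals of a bounded family tend to zero. -/
def weakNullSubmodule [IsFiniteMeasure μ] (l : Filter ι) (g : ι → X → ℝ)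
    (hm : ∀ k, Measurable (g k)) (hC : ∃ C, ∀ k x, |g k x| ≤ C) : Submodule ℝ (Lp ℝ 2 μ) where
  carrier := {F | Tendsto (fun k => ∫ x, F x * g k x ∂μ) l (𝓝 0)}
  zero_mem' := by
    refine (tendsto_const_nhds (x := (0 : ℝ))).congr fun k => ?_
    rw [← integral_zero X ℝ (μ := μ)]
    refine integral_congr_ae ?_
    filter_upwards [Lp.coeFn_zero ℝ 2 μ] with x hx
    erw [hx]
    simp
  add_mem' := by
    rintro F G hF hG
    obtain ⟨C, hC⟩ := hC
    have := Tendsto.add hF hG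
    rw [add_zero] at this
    refine this.congr fun k => ?_
    rw [← integral_add (integrable_lp_mul F (hm k) (hC k)) (integrable_lp_mul G (hm k) (hC k))]
    refine integral_congr_ae ?_
    filter_upwards [Lp.coeFn_add F G] with x hx
    rw [hx, Pi.add_apply]; ring
  smul_mem' := by
    rintro c F hF
    have := Tendsto.const_mul c hF
    rw [mul_zero] at this
    refine this.congr fun k => ?_
    rw [← integral_const_mul]
    refine integral_congr_ae ?_
    filter_upwards [Lp.coeFn_smul c F] with x hx
    rw [hx, Pi.smul_apply, smul_eq_mul]; ring

theorem mem_weakNullSubmodule [IsFiniteMeasure μ] {g : ι → X → ℝ}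
    {hm : ∀ k, Measurable (g k)} {hC : ∃ C, ∀ k x, |g k x| ≤ C} {F : Lp ℝ 2 μ} :
    F ∈ weakNullSubmodule l g hm hC ↔ Tendsto (fun k => ∫ x, F x * g k x ∂μ) l (𝓝 0) := Iff.rfl

/-- The functionals given by integration against `g k` are bounded uniformly in `k`, so convergence
to zero passes to norm limits of `F`. -/
theorem isClosed_weakNullSubmodule [IsProbabilityMeasure μ] {g : ι → X → ℝ}
    {hm : ∀ k, Measurable (g k)} {hC : ∃ C, ∀ k x, |g k x| ≤ C} :
    IsClosed (weakNullSubmodule (μ := μ) l g hm hC : Set (Lp ℝ 2 μ)) := by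
  refine isClosed_of_closure_subset fun F hF => ?_
  have hC' := hC
  obtain ⟨C, hC'⟩ := hC'
  rw [SetLike.mem_coe, mem_weakNullSubmodule, Metric.tendsto_nhds]
  intro ε hε
  have hη : 0 < ε / (2 * (|C| + 1)) := by positivity
  obtain ⟨G, hG, hFG⟩ := Metric.mem_closure_iff.1 hF _ hη
  filter_upwards [Metric.tendsto_nhds.1 (mem_weakNullSubmodule.1 hG) (ε / 2) (by positivity)]
    with k hk
  have hgm : MemLp (g k) 2 μ := memLp_of_bound (hm k) (hC' k)
  have h1 := abs_integral_lp_mul_le (F - G) hgm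
  have h2 : (eLpNorm (g k) 2 μ).toReal ≤ |C| := by
    refine ENNReal.toReal_le_of_le_ofReal (abs_nonneg C) ?_
    refine (eLpNorm_le_of_ae_bound (C := |C|)
      (ae_of_all _ fun x => (hC' k x).trans (le_abs_self C))).trans ?_
    simp
  have h3 : ‖F - G‖ * (eLpNorm (g k) 2 μ).toReal ≤ ε / 2 := by
    rw [dist_eq_norm] at hFG
    calc ‖F - G‖ * (eLpNorm (g k) 2 μ).toReal
        ≤ (ε / (2 * (|C| + 1))) * (|C| + 1) := by
          gcongr; linarith
      _ = ε / 2 := by field_simp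
  have h4 : ∫ x, (F - G : Lp ℝ 2 μ) x * g k x ∂μ
      = (∫ x, F x * g k x ∂μ) - ∫ x, G x * g k x ∂μ := by
    rw [← integral_sub (integrable_lp_mul F (hm k) (hC' k)) (integrable_lp_mul G (hm k) (hC' k))]
    refine integral_congr_ae ?_
    filter_upwards [Lp.coeFn_sub F G] with x hx
    rw [hx, Pi.sub_apply]; ring
  rw [h4] at h1
  rw [Real.dist_eq, sub_zero] at hk ⊢
  have h5 := abs_add_le ((∫ x, F x * g k x ∂μ) - ∫ x, G x * g k x ∂μ) (∫ x, G x * g k x ∂μ)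
  rw [sub_add_cancel] at h5
  linarith

/-- If a bounded family is weakly null against the orthogonal complements of the spaces of
invariant functions of two relations, and all functions invariant under both relations are
constant, then it is weakly null against all functions of mean zero. -/
theorem tendsto_integral_mul_of_orthogonal [IsProbabilityMeasure μ] {W' : X → X → Prop}
    {g : ι → X → ℝ} (hm : ∀ k, Measurable (g k)) (hC : ∃ C, ∀ k x, |g k x| ≤ C)
    (h₁ : ∀ F ∈ (lpMeas ℝ ℝ (invariantSpace W μ) 2 μ)ᗮ,
      Tendsto (fun k => ∫ x, F x * g k x ∂μ) l (𝓝 0))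
    (h₂ : ∀ F ∈ (lpMeas ℝ ℝ (invariantSpace W' μ) 2 μ)ᗮ,
      Tendsto (fun k => ∫ x, F x * g k x ∂μ) l (𝓝 0))
    (htriv : ∀ h : X → ℝ, Measurable h → IsAEInvariant W μ h → IsAEInvariant W' μ h →
      ∃ c : ℝ, ∀ᵐ x ∂μ, h x = c)
    {F : Lp ℝ 2 μ} (hF : ∫ x, F x ∂μ = 0) :
    Tendsto (fun k => ∫ x, F x * g k x ∂μ) l (𝓝 0) := by
  have : Fact (invariantSpace W μ ≤ ‹MeasurableSpace X›) := ⟨invariantSpace_le⟩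
  have : Fact (invariantSpace W' μ ≤ ‹MeasurableSpace X›) := ⟨invariantSpace_le⟩
  set S := weakNullSubmodule (μ := μ) l g hm hC with hS
  have : CompleteSpace S := isClosed_weakNullSubmodule.completeSpace_coe
  suffices F ∈ S from this
  -- Since `S` is closed, it suffices to test `F` against `G` orthogonal to `S`. Such a `G` is
  -- orthogonal to both orthogonal complements, hence invariant under both relations, hence
  -- constant.
  rw [← Submodule.orthogonal_orthogonal S, Submodule.mem_orthogonal]
  intro G hG
  have hG₁ : G ∈ lpMeas ℝ ℝ (invariantSpace W μ) 2 μ := by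
    rw [← Submodule.orthogonal_orthogonal (lpMeas ℝ ℝ (invariantSpace W μ) 2 μ)]
    exact Submodule.orthogonal_le (fun F hF => h₁ F hF) hG
  have hG₂ : G ∈ lpMeas ℝ ℝ (invariantSpace W' μ) 2 μ := by
    rw [← Submodule.orthogonal_orthogonal (lpMeas ℝ ℝ (invariantSpace W' μ) 2 μ)]
    exact Submodule.orthogonal_le (fun F hF => h₂ F hF) hG
  rw [mem_lpMeas_iff_aestronglyMeasurable] at hG₁ hG₂
  have hGm : Measurable G := (Lp.stronglyMeasurable G).measurable
  obtain ⟨c, hc⟩ := htriv G hGm ((aestronglyMeasurable_invariantSpace_iff hGm).1 hG₁)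
    ((aestronglyMeasurable_invariantSpace_iff hGm).1 hG₂)
  rw [L2.inner_def]
  have : ∫ x, inner ℝ (G x) (F x) ∂μ = ∫ x, c * F x ∂μ := by
    refine integral_congr_ae ?_
    filter_upwards [hc] with x hx
    simp [hx, mul_comm]
  rw [this, integral_const_mul, hF, mul_zero]

/-- A bounded function is the sum of a bounded invariant function and of a bounded function which
is orthogonal to the invariant functions. -/
theorem exists_isAEInvariant_sub_mem_orthogonal [IsProbabilityMeasure μ] (W : X → X → Prop)
    {φ : X → ℝ} (hφ : IsBddMeasurable φ) :
    ∃ a : X → ℝ, IsBddMeasurable a ∧ IsAEInvariant W μ a ∧ (∫ x, a x ∂μ = ∫ x, φ x ∂μ) ∧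
      ∀ h : MemLp (φ - a) 2 μ, h.toLp _ ∈ (lpMeas ℝ ℝ (invariantSpace W μ) 2 μ)ᗮ := by
  have : Fact (invariantSpace W μ ≤ ‹MeasurableSpace X›) := ⟨invariantSpace_le⟩
  have hle : invariantSpace W μ ≤ ‹MeasurableSpace X› := invariantSpace_le
  obtain ⟨C, hC⟩ := hφ.2
  have hbd : ∀ᵐ x ∂μ, |(μ[φ | invariantSpace W μ]) x| ≤ C :=
    ae_bdd_abs_condExp_of_ae_bdd_abs (ae_of_all _ hC)
  have hcm : Measurable[invariantSpace W μ] (μ[φ | invariantSpace W μ]) :=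
    stronglyMeasurable_condExp.measurable
  -- The conditional expectation is bounded only almost everywhere; truncation makes the bound hold
  -- everywhere and keeps measurability for the invariant sets.
  set a : X → ℝ := fun x => max (-|C|) (min |C| ((μ[φ | invariantSpace W μ]) x)) with ha
  have ham : Measurable[invariantSpace W μ] a := measurable_const.max (measurable_const.min hcm)
  have hae : a =ᵐ[μ] μ[φ | invariantSpace W μ] := by
    filter_upwards [hbd] with x hx
    have := abs_le.1 (hx.trans (le_abs_self C))
    simp only [ha]
    rw [min_eq_right this.2, max_eq_right this.1]
  refine ⟨a, ⟨ham.mono hle le_rfl, |C|, fun x => ?_⟩, isAEInvariant_of_measurable ham, ?_, ?_⟩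
  · rw [abs_le]
    exact ⟨le_max_left _ _, max_le (by linarith [abs_nonneg C]) (min_le_left _ _)⟩
  · rw [integral_congr_ae hae, integral_condExp hle]
  · intro h
    have hφ2 : MemLp φ 2 μ := hφ.memLp
    have heq : h.toLp (φ - a)
        = hφ2.toLp φ - (condExpL2 ℝ ℝ hle (hφ2.toLp φ) : Lp ℝ 2 μ) := by
      apply Lp.ext
      filter_upwards [h.coeFn_toLp, Lp.coeFn_sub (hφ2.toLp φ)
        (condExpL2 ℝ ℝ hle (hφ2.toLp φ) : Lp ℝ 2 μ), hφ2.coeFn_toLp,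
        hφ2.condExpL2_ae_eq_condExp (𝕜 := ℝ) hle, hae] with x h1 h2 h3 h4 h5
      rw [h1, h2, Pi.sub_apply, Pi.sub_apply, h3, h4, h5]
    rw [heq]
    exact Submodule.sub_starProjection_mem_orthogonal _

end

/-! ### Uniformly continuous approximation -/

section

variable {X ι : Type*} [PseudoMetricSpace X] [MeasurableSpace X] [BorelSpace X]
  {W : X → X → Prop} {μ : Measure X} {l : Filter ι}

/-- Bounded uniformly continuous functions are dense in `L²`. -/
theorem exists_uniformContinuous_eLpNorm_sub_le [IsFiniteMeasure μ] {φ : X → ℝ}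
    (hφ : MemLp φ 2 μ) {ε : ENNReal} (hε : ε ≠ 0) :
    ∃ g : X → ℝ, eLpNorm (φ - g) 2 μ ≤ ε ∧ UniformContinuous g ∧ ∃ C, ∀ x, |g x| ≤ C := by
  refine hφ.induction_dense (by simp) (fun g => UniformContinuous g ∧ ∃ C, ∀ x, |g x| ≤ C)
    ?_ ?_ ?_ hε
  · intro c s hs _ ε hε
    obtain ⟨η, hη, hηs⟩ := exists_eLpNorm_indicator_le (μ := μ) (p := 2) (by simp) c hε
    have hη2 : ((η : ENNReal) / 2) ≠ 0 := by simpa using hη.ne'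
    -- With `K ⊆ s` closed, the thickened indicator of `K` differs from the indicator of `s` only on
    -- `s \ K` and on the thin shell around `K`, each of measure at most `η / 2`.
    obtain ⟨K, hKs, hK, hsK⟩ := hs.exists_isClosed_sdiff_lt (measure_ne_top μ s) hη2
    have hlim := tendsto_measure_cthickening_of_isClosed (μ := μ) (s := K)
      ⟨1, one_pos, measure_ne_top _ _⟩ hK
    have hlt : μ K < μ K + η / 2 := ENNReal.lt_add_right (measure_ne_top _ _) hη2
    have hev : ∀ᶠ r in 𝓝[>] (0 : ℝ), μ (Metric.cthickening r K) < μ K + η / 2 :=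
      (hlim.eventually_lt_const hlt).filter_mono nhdsWithin_le_nhds
    obtain ⟨δ, hδ, hδ0⟩ := (hev.and self_mem_nhdsWithin).exists
    have hδ0 : 0 < δ := hδ0
    have hth : μ (Metric.thickening δ K \ K) ≤ η / 2 := by
      rw [measure_sdiff (Metric.self_subset_thickening hδ0 K) hK.measurableSet.nullMeasurableSet
        (measure_ne_top _ _)]
      refine tsub_le_iff_left.2 ((measure_mono (Metric.thickening_subset_cthickening δ K)).trans
        hδ.le)
    refine ⟨fun x => c * (thickenedIndicator hδ0 K x : ℝ), ?_, ?_, |c|, fun x => ?_⟩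
    · refine le_trans (eLpNorm_mono fun x => ?_)
        (hηs ((Metric.thickening δ K \ K) ∪ (s \ K)) ?_)
      · simp only [Pi.sub_apply]
        by_cases hxK : x ∈ K
        · simp [thickenedIndicator_one hδ0 K hxK, hKs hxK, hxK]
        · by_cases hxT : x ∈ Metric.thickening δ K
          · have h1 := thickenedIndicator_le_one hδ0 K x
            have h1' : ((thickenedIndicator hδ0 K x : NNReal) : ℝ) ≤ 1 := by exact_mod_cast h1
            have h0 : (0 : ℝ) ≤ thickenedIndicator hδ0 K x := NNReal.coe_nonneg _
            rw [Set.indicator_of_mem (show x ∈ (Metric.thickening δ K \ K) ∪ (s \ K) from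
              Or.inl ⟨hxT, hxK⟩)]
            by_cases hxs : x ∈ s
            · rw [Set.indicator_of_mem hxs, ← mul_sub_one, norm_mul]
              refine mul_le_of_le_one_right (norm_nonneg _) ?_
              rw [Real.norm_eq_abs, abs_le]; constructor <;> linarith
            · rw [Set.indicator_of_notMem hxs, sub_zero, norm_mul]
              refine mul_le_of_le_one_right (norm_nonneg _) ?_
              rw [Real.norm_eq_abs, abs_le]; constructor <;> linarith
          · rw [thickenedIndicator_zero hδ0 K hxT]
            by_cases hxs : x ∈ s
            · simp [hxs, hxK]
            · simp [hxs]
      · calc μ ((Metric.thickening δ K \ K) ∪ (s \ K)) ≤ η / 2 + η / 2 :=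
              (measure_union_le _ _).trans (add_le_add hth hsK.le)
          _ = η := ENNReal.add_halves _
    · have := (lipschitzWith_thickenedIndicator hδ0 K).uniformContinuous
      exact (uniformContinuous_subtype_val.comp this).const_mul' c
    · have h1 := thickenedIndicator_le_one hδ0 K x
      have h1' : ((thickenedIndicator hδ0 K x : NNReal) : ℝ) ≤ 1 := by exact_mod_cast h1
      rw [abs_mul, NNReal.abs_eq]
      exact mul_le_of_le_one_right (abs_nonneg _) h1'
  · rintro f g ⟨hf, C, hC⟩ ⟨hg, D, hD⟩
    exact ⟨hf.add hg, C + D, fun x => (abs_add_le _ _).trans (add_le_add (hC x) (hD x))⟩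
  · rintro f ⟨hf, -⟩
    exact hf.continuous.measurable.aestronglyMeasurable

/-- If the maps `S k` preserve `μ` and contract the classes of `W` asymptotically, then the
compositions of a bounded function with them are approximately invariant. -/
theorem isApproxInvariant_comp [IsFiniteMeasure μ] {S : ι → X → X}
    (hS : ∀ k, MeasurePreserving (S k) μ μ)
    (hW : ∀ x y, W x y → Tendsto (fun k => dist (S k x) (S k y)) l (𝓝 0))
    {φ : X → ℝ} (hφ : IsBddMeasurable φ) : IsApproxInvariant W μ l (fun k => φ ∘ S k) := by
  obtain ⟨C, hC⟩ := hφ.2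
  refine ⟨⟨C, fun k x => hC _⟩, fun k => hφ.1.comp (hS k).measurable, fun ε hε => ?_⟩
  obtain ⟨g, hg, hgu, D, hD⟩ :=
    exists_uniformContinuous_eLpNorm_sub_le (μ := μ) hφ.memLp hε
  have hgm : Measurable g := hgu.continuous.measurable
  refine ⟨fun k => g ∘ S k, ⟨⟨D, fun k x => hD _⟩, fun k => hgm.comp (hS k).measurable,
    Set.univ, by simp, fun x _ y _ hxy => ?_⟩, fun k => ?_⟩
  · rw [Metric.tendsto_nhds]
    intro η hη
    obtain ⟨δ, hδ, hgδ⟩ := Metric.uniformContinuous_iff.1 hgu η hη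
    filter_upwards [Metric.tendsto_nhds.1 (hW x y hxy) δ hδ] with k hk
    rw [Real.dist_eq, sub_zero, abs_of_nonneg dist_nonneg] at hk
    have := hgδ hk
    rw [Real.dist_eq] at this
    rwa [Real.dist_eq, sub_zero]
  -- Because `S k` preserves `μ`, the error does not depend on `k`.
  · have : φ ∘ S k - g ∘ S k = (φ - g) ∘ S k := rfl
    rw [this, eLpNorm_comp_measurePreserving (hφ.1.sub hgm).aestronglyMeasurable (hS k)]
    exact hg

end

/-! ### Integer iterates and correlations -/

section

variable {X ι : Type*} [MeasurableSpace X] {μ : Measure X}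

/-- Integer iterates of a measurable automorphism. -/
def zIterate (f : X ≃ᵐ X) (t : ℤ) : X → X := ((f.toEquiv : Equiv.Perm X) ^ t : Equiv.Perm X)

theorem zIterate_zero (f : X ≃ᵐ X) (x : X) : zIterate f 0 x = x := by simp [zIterate]

theorem zIterate_add (f : X ≃ᵐ X) (s t : ℤ) (x : X) :
    zIterate f (s + t) x = zIterate f s (zIterate f t x) := by
  simp [zIterate, zpow_add]

theorem zIterate_natCast (f : X ≃ᵐ X) (n : ℕ) : zIterate f n = f^[n] := by
  simp only [zIterate, zpow_natCast, ← Equiv.Perm.iterate_eq_pow]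
  rfl

theorem zIterate_neg_natCast (f : X ≃ᵐ X) (n : ℕ) : zIterate f (-n) = f.symm^[n] := by
  simp only [zIterate, zpow_neg, zpow_natCast, ← inv_pow, ← Equiv.Perm.iterate_eq_pow]
  rfl

theorem measurePreserving_zIterate {f : X ≃ᵐ X} (hf : MeasurePreserving f μ μ) (t : ℤ) :
    MeasurePreserving (zIterate f t) μ μ := by
  obtain ⟨n, rfl | rfl⟩ := t.eq_nat_or_neg
  · rw [zIterate_natCast]; exact hf.iterate n
  · rw [zIterate_neg_natCast]; exact (hf.symm f).iterate n

theorem IsBddMeasurable.comp {φ : X → ℝ} (hφ : IsBddMeasurable φ) {S : X → X}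
    (hS : Measurable S) : IsBddMeasurable (fun x => φ (S x)) :=
  ⟨hφ.1.comp hS, hφ.2.choose, fun _ => hφ.2.choose_spec _⟩

theorem IsBddMeasurable.mul {φ ψ : X → ℝ} (hφ : IsBddMeasurable φ) (hψ : IsBddMeasurable ψ) :
    IsBddMeasurable (fun x => φ x * ψ x) := by
  obtain ⟨hφ, C, hC⟩ := hφ
  obtain ⟨hψ, D, hD⟩ := hψ
  refine ⟨hφ.mul hψ, C * D, fun x => ?_⟩
  rw [abs_mul]
  exact mul_le_mul (hC x) (hD x) (abs_nonneg _) ((abs_nonneg _).trans (hC x))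

theorem IsBddMeasurable.sub {φ ψ : X → ℝ} (hφ : IsBddMeasurable φ) (hψ : IsBddMeasurable ψ) :
    IsBddMeasurable (φ - ψ) := by
  obtain ⟨hφ, C, hC⟩ := hφ
  obtain ⟨hψ, D, hD⟩ := hψ
  exact ⟨hφ.sub hψ, C + D, fun x => (abs_sub _ _).trans (add_le_add (hC x) (hD x))⟩

theorem isBddMeasurable_const (c : ℝ) : IsBddMeasurable (fun _ : X => c) :=
  ⟨measurable_const, |c|, fun _ => le_rfl⟩

theorem IsBddMeasurable.prod {κ : Type*} {φ : κ → X → ℝ} (s : Finset κ)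
    (hφ : ∀ i ∈ s, IsBddMeasurable (φ i)) : IsBddMeasurable (fun x => ∏ i ∈ s, φ i x) := by
  classical
  induction s using Finset.induction_on with
  | empty => simpa using isBddMeasurable_const 1
  | insert a s ha ih =>
    simp only [Finset.prod_insert ha]
    exact (hφ a (by simp)).mul (ih fun j hj => hφ j (by simp [hj]))

theorem IsBddMeasurable.integrable [IsFiniteMeasure μ] {φ : X → ℝ} (hφ : IsBddMeasurable φ) :
    Integrable φ μ := memLp_one_iff_integrable.1 hφ.memLp

theorem integral_comp_zIterate {f : X ≃ᵐ X} (hf : MeasurePreserving f μ μ) (t : ℤ) {φ : X → ℝ}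
    (hφ : Measurable φ) : ∫ x, φ (zIterate f t x) ∂μ = ∫ x, φ x ∂μ := by
  have hmp := measurePreserving_zIterate hf t
  rw [← integral_map hmp.measurable.aemeasurable hφ.aestronglyMeasurable, hmp.map_eq]

/-- Correlations only depend on the differences of the times. -/
theorem integral_mul_prod_zIterate {f : X ≃ᵐ X} (hf : MeasurePreserving f μ μ) {κ : Type*}
    (s : Finset κ) {b : X → ℝ} (hb : IsBddMeasurable b) {φ : κ → X → ℝ}
    (hφ : ∀ i ∈ s, IsBddMeasurable (φ i)) (t₀ : ℤ) (t : κ → ℤ) :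
    ∫ x, b (zIterate f t₀ x) * ∏ i ∈ s, φ i (zIterate f (t i) x) ∂μ
      = ∫ x, b x * ∏ i ∈ s, φ i (zIterate f (t i - t₀) x) ∂μ := by
  rw [← integral_comp_zIterate hf t₀ (φ := fun x => b x * ∏ i ∈ s, φ i (zIterate f (t i - t₀) x))]
  · simp only [← zIterate_add, sub_add_cancel]
  · exact (hb.mul (.prod s fun i hi =>
      (hφ i hi).comp (measurePreserving_zIterate hf _).measurable)).1

theorem integral_toLp_mul {b : X → ℝ} (hb : MemLp b 2 μ) (g : X → ℝ) :
    ∫ x, hb.toLp b x * g x ∂μ = ∫ x, b x * g x ∂μ := by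
  refine integral_congr_ae ?_
  filter_upwards [hb.coeFn_toLp] with x hx
  rw [hx]

/-- If a relation is preserved by the iterates of `f`, then the compositions of an invariant
function with iterates of `f` form an asymptotically invariant family. -/
theorem isAsympInvariant_comp_zIterate {W : X → X → Prop} {f : X ≃ᵐ X}
    (hf : MeasurePreserving f μ μ)
    (hW : ∀ t x y, W x y → W (zIterate f t x) (zIterate f t y)) {φ : X → ℝ}
    (hφ : IsBddMeasurable φ) (hi : IsAEInvariant W μ φ) (l : Filter ι) (t : ι → ℤ) :
    IsAsympInvariant W μ l (fun k => φ ∘ zIterate f (t k)) := by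
  obtain ⟨E, hE, hi⟩ := hi
  obtain ⟨C, hC⟩ := hφ.2
  refine ⟨⟨C, fun k x => hC _⟩,
    fun k => hφ.1.comp (measurePreserving_zIterate hf _).measurable,
    -- Keeping only points whose whole orbit stays in `E` still excludes only a null set, by
    -- countability of `ℤ`.
    {x | ∀ s, zIterate f s x ∈ E}, ?_, fun x hx y hy hxy => ?_⟩
  · exact ae_all_iff.2 fun s => (measurePreserving_zIterate hf s).quasiMeasurePreserving.ae hE
  · refine tendsto_const_nhds.congr fun k => ?_
    simp only [Function.comp_apply]
    rw [hi _ (hx (t k)) _ (hy (t k)) (hW _ _ _ hxy), sub_self]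

theorem IsAEInvariant.comp_zIterate {W : X → X → Prop} {f : X ≃ᵐ X}
    (hf : MeasurePreserving f μ μ)
    (hW : ∀ t x y, W x y → W (zIterate f t x) (zIterate f t y)) {φ : X → ℝ}
    (hi : IsAEInvariant W μ φ) (t : ℤ) : IsAEInvariant W μ (fun x => φ (zIterate f t x)) := by
  obtain ⟨E, hE, hi⟩ := hi
  exact ⟨zIterate f t ⁻¹' E, (measurePreserving_zIterate hf t).quasiMeasurePreserving.ae hE,
    fun x hx y hy hxy => hi _ hx _ hy (hW _ _ _ hxy)⟩

end

/-! ### Stable and unstable sets, and decay of multiple correlations -/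

section

variable {X ι : Type*} [MetricSpace X] [MeasurableSpace X] {μ : Measure X}

theorem mem_stableSet_iff (f : X ≃ᵐ X) (x y : X) : y ∈ stableSet f x ↔
    Tendsto (fun t : ℤ => dist (zIterate f t x) (zIterate f t y)) atTop (𝓝 0) := by
  rw [← Nat.map_cast_int_atTop, tendsto_map'_iff]
  simp only [Function.comp_def, zIterate_natCast]
  rfl

theorem mem_unstableSet_iff (f : X ≃ᵐ X) (x y : X) : y ∈ unstableSet f x ↔
    Tendsto (fun t : ℤ => dist (zIterate f t x) (zIterate f t y)) atBot (𝓝 0) := by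
  rw [← map_neg_atTop (G := ℤ), tendsto_map'_iff, ← Nat.map_cast_int_atTop, tendsto_map'_iff]
  simp only [Function.comp_def, zIterate_neg_natCast]
  rfl

theorem zIterate_mem_stableSet (f : X ≃ᵐ X) (t : ℤ) (x y : X) (h : y ∈ stableSet f x) :
    zIterate f t y ∈ stableSet f (zIterate f t x) := by
  rw [mem_stableSet_iff] at h ⊢
  simp only [← zIterate_add]
  exact h.comp (tendsto_atTop_add_const_right _ t tendsto_id)

theorem zIterate_mem_unstableSet (f : X ≃ᵐ X) (t : ℤ) (x y : X) (h : y ∈ unstableSet f x) :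
    zIterate f t y ∈ unstableSet f (zIterate f t x) := by
  rw [mem_unstableSet_iff] at h ⊢
  simp only [← zIterate_add]
  exact h.comp (tendsto_atBot_add_const_right _ t tendsto_id)

variable [BorelSpace X] {l : Filter ι}

theorem isApproxInvariant_stable [IsFiniteMeasure μ] {f : X ≃ᵐ X} (hf : MeasurePreserving f μ μ)
    {t : ι → ℤ} (ht : Tendsto t l atTop) {φ : X → ℝ} (hφ : IsBddMeasurable φ) :
    IsApproxInvariant (fun x y => y ∈ stableSet f x) μ l (fun k => φ ∘ zIterate f (t k)) :=
  isApproxInvariant_comp (fun k => measurePreserving_zIterate hf (t k))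
    (fun x y hxy => ((mem_stableSet_iff f x y).1 hxy).comp ht) hφ

theorem isApproxInvariant_unstable [IsFiniteMeasure μ] {f : X ≃ᵐ X}
    (hf : MeasurePreserving f μ μ) {t : ι → ℤ} (ht : Tendsto t l atBot) {φ : X → ℝ}
    (hφ : IsBddMeasurable φ) :
    IsApproxInvariant (fun x y => y ∈ unstableSet f x) μ l (fun k => φ ∘ zIterate f (t k)) :=
  isApproxInvariant_comp (fun k => measurePreserving_zIterate hf (t k))
    (fun x y hxy => ((mem_unstableSet_iff f x y).1 hxy).comp ht) hφ

/-- If all functions which are both stably and unstably invariant are constant, then all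
multiple correlations of bounded functions decay as the gaps between the times grow. -/
theorem tendsto_integral_prod_zIterate [IsProbabilityMeasure μ] [l.IsCountablyGenerated]
    {f : X ≃ᵐ X} (hf : MeasurePreserving f μ μ)
    (htriv : ∀ h : X → ℝ, Measurable h → IsAEInvariant (fun x y => y ∈ stableSet f x) μ h →
      IsAEInvariant (fun x y => y ∈ unstableSet f x) μ h → ∃ c : ℝ, ∀ᵐ x ∂μ, h x = c)
    (N : ℕ) : ∀ (φ : Fin N → X → ℝ), (∀ i, IsBddMeasurable (φ i)) → ∀ t : Fin N → ι → ℤ,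
      (∀ i j, i < j → Tendsto (fun k => t j k - t i k) l atTop) →
      Tendsto (fun k => ∫ x, ∏ i, φ i (zIterate f (t i k) x) ∂μ) l
        (𝓝 (∏ i, ∫ x, φ i x ∂μ)) := by
  induction N with
  | zero => intro φ _ t _; simpa using tendsto_const_nhds
  | succ N ih =>
    intro φ hφ t ht
    have hcomp : ∀ (ψ : X → ℝ) (s : ℤ), IsBddMeasurable ψ →
        IsBddMeasurable (fun x => ψ (zIterate f s x)) :=
      fun ψ s hψ => hψ.comp (measurePreserving_zIterate hf s).measurable
    -- the functions after the `n`-th one may be taken unstably invariant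
    suffices H : ∀ n : ℕ, ∀ φ : Fin (N + 1) → X → ℝ, (∀ i, IsBddMeasurable (φ i)) →
        (∀ i : Fin (N + 1), n < (i : ℕ) →
          IsAEInvariant (fun x y => y ∈ unstableSet f x) μ (φ i)) →
        Tendsto (fun k => ∫ x, ∏ i, φ i (zIterate f (t i k) x) ∂μ) l
          (𝓝 (∏ i, ∫ x, φ i x ∂μ)) from
      -- For `n = N` no index lies beyond `n`, so the invariance condition is vacuous.
      H N φ hφ fun i hi => absurd i.is_lt (by omega)
    intro n
    induction n with
    | zero =>
      intro φ hφ hu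
      -- All later factors as seen from time `t 0`: stably invariant in the limit because the gaps
      -- tend to `+∞`, unstably invariant because each factor is.
      set g : ι → X → ℝ := fun k => ∏ j : Fin N, φ j.succ ∘ zIterate f (t j.succ k - t 0 k) with hg
      have hs : IsApproxInvariant (fun x y => y ∈ stableSet f x) μ l g :=
        IsApproxInvariant.prod (g := fun j k => φ (Fin.succ j) ∘ zIterate f (t j.succ k - t 0 k))
          Finset.univ fun j _ => isApproxInvariant_stable hf (ht 0 j.succ (Fin.succ_pos j)) (hφ _)
      have hu' : IsApproxInvariant (fun x y => y ∈ unstableSet f x) μ l g :=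
        IsApproxInvariant.prod (g := fun j k => φ (Fin.succ j) ∘ zIterate f (t j.succ k - t 0 k))
          Finset.univ fun j _ => (isAsympInvariant_comp_zIterate hf
            (zIterate_mem_unstableSet f) (hφ _) (hu j.succ (by simp)) l _).approx
      set c := ∫ x, φ 0 x ∂μ with hc
      have hb : IsBddMeasurable (φ 0 - fun _ => c) := (hφ 0).sub (isBddMeasurable_const c)
      have hb2 : MemLp (φ 0 - fun _ => c) 2 μ := hb.memLp
      have hb0 : ∫ x, hb2.toLp _ x ∂μ = 0 := by
        rw [integral_congr_ae hb2.coeFn_toLp]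
        simp only [Pi.sub_apply]
        rw [integral_sub (hφ 0).integrable (integrable_const c)]
        simp [hc]
      have h1 := tendsto_integral_mul_of_orthogonal hs.2.1 hs.1
        (fun F hF => hs.tendsto_integral_mul hF) (fun F hF => hu'.tendsto_integral_mul hF)
        htriv hb0
      have h2 := (ih (fun j => φ j.succ) (fun j => hφ _) (fun j k => t j.succ k)
        (fun i j hij => ht _ _ (Fin.succ_lt_succ_iff.2 hij))).const_mul c
      have h3 := h1.add h2
      rw [zero_add] at h3
      rw [Fin.prod_univ_succ]
      refine h3.congr fun k => ?_
      have hgk : ∀ x, g k x = ∏ j : Fin N, φ j.succ (zIterate f (t j.succ k - t 0 k) x) := by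
        intro x; simp [hg, Finset.prod_apply]
      have hgb : IsBddMeasurable (g k) := ⟨hs.2.1 k, hs.1.choose, hs.1.choose_spec k⟩
      have h4 : ∫ x, ∏ j : Fin N, φ j.succ (zIterate f (t j.succ k) x) ∂μ = ∫ x, g k x ∂μ := by
        have := integral_mul_prod_zIterate hf Finset.univ (isBddMeasurable_const 1)
          (φ := fun j : Fin N => φ j.succ) (fun j _ => hφ _) (t 0 k) (fun j => t j.succ k)
        simpa only [one_mul, ← hgk] using this
      have h5 : ∫ x, ∏ i, φ i (zIterate f (t i k) x) ∂μ = ∫ x, φ 0 x * g k x ∂μ := by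
        simp only [Fin.prod_univ_succ, hgk]
        exact integral_mul_prod_zIterate hf Finset.univ (hφ 0)
          (φ := fun j : Fin N => φ j.succ) (fun j _ => hφ _) (t 0 k) (fun j => t j.succ k)
      rw [h4, h5, integral_toLp_mul, ← integral_const_mul, ← integral_add (hb.mul hgb).integrable
        (hgb.integrable.const_mul c)]
      congr 1 with x
      simp only [Pi.sub_apply]; ring
    | succ n ihn =>
      intro φ hφ hu
      by_cases hn : n + 1 < N + 1
      swap
      · exact ihn φ hφ fun i hi => hu i (by have := i.is_lt; omega)
      set i₀ : Fin (N + 1) := ⟨n + 1, hn⟩ with hi₀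
      -- Replacing `φ i₀` by its unstably invariant part `a` keeps its mean and reduces to the case
      -- `n`; the remainder `φ i₀ - a` is orthogonal to the unstably invariant functions.
      obtain ⟨a, ha, hai, haint, horth⟩ := exists_isAEInvariant_sub_mem_orthogonal (μ := μ)
        (fun x y => y ∈ unstableSet f x) (hφ i₀)
      have hb : IsBddMeasurable (φ i₀ - a) := (hφ i₀).sub ha
      set g : ι → X → ℝ := fun k => ∏ j ∈ Finset.univ.erase i₀,
        φ j ∘ zIterate f (t j k - t i₀ k) with hg
      have hgu : IsApproxInvariant (fun x y => y ∈ unstableSet f x) μ l g := by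
        refine IsApproxInvariant.prod (g := fun j k => φ j ∘ zIterate f (t j k - t i₀ k)) _
          fun j hj => ?_
        -- Seen from `t i₀`, earlier times tend to `-∞`, while the functions at later times are
        -- unstably invariant by hypothesis.
        rcases lt_or_gt_of_ne (Finset.ne_of_mem_erase hj) with hlt | hlt
        · refine isApproxInvariant_unstable hf ?_ (hφ j)
          have := tendsto_neg_atTop_atBot.comp (ht j i₀ hlt)
          simpa [Function.comp_def] using this
        · exact (isAsympInvariant_comp_zIterate hf (zIterate_mem_unstableSet f) (hφ _)
            (hu j hlt) l _).approx
      have h1 := hgu.tendsto_integral_mul (horth hb.memLp)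
      have hφ' : ∀ i, IsBddMeasurable (Function.update φ i₀ a i) := by
        intro i
        rcases eq_or_ne i i₀ with rfl | hi
        · simpa using ha
        · simpa [hi] using hφ i
      have h2 := ihn (Function.update φ i₀ a) hφ' (fun i hi => by
        rcases eq_or_ne i i₀ with rfl | hne
        · simpa using hai
        · have : n + 1 < (i : ℕ) := by
            have : (i : ℕ) ≠ n + 1 := fun h => hne (Fin.ext h)
            omega
          simpa [hne] using hu i this)
      have hlim : ∏ i, ∫ x, Function.update φ i₀ a i x ∂μ = ∏ i, ∫ x, φ i x ∂μ := by
        refine Finset.prod_congr rfl fun i _ => ?_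
        rcases eq_or_ne i i₀ with rfl | hi
        · simpa using haint
        · simp [hi]
      have h3 := h1.add h2
      rw [zero_add, hlim] at h3
      refine h3.congr fun k => ?_
      have hgk : ∀ x, g k x = ∏ j ∈ Finset.univ.erase i₀,
          φ j (zIterate f (t j k - t i₀ k) x) := by
        intro x; simp [hg, Finset.prod_apply]
      have h4 : ∫ x, (φ i₀ - a) x * g k x ∂μ
          = ∫ x, (φ i₀ - a) (zIterate f (t i₀ k) x) *
            ∏ j ∈ Finset.univ.erase i₀, φ j (zIterate f (t j k) x) ∂μ := by
        simp only [hgk]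
        exact (integral_mul_prod_zIterate hf _ hb (fun j _ => hφ j) (t i₀ k)
          (fun j => t j k)).symm
      rw [integral_toLp_mul, h4, ← integral_add]
      · congr 1 with x
        rw [← Finset.mul_prod_erase Finset.univ (fun i => φ i (zIterate f (t i k) x))
            (Finset.mem_univ i₀),
          ← Finset.mul_prod_erase Finset.univ
            (fun i => Function.update φ i₀ a i (zIterate f (t i k) x)) (Finset.mem_univ i₀)]
        have : ∏ j ∈ Finset.univ.erase i₀, Function.update φ i₀ a j (zIterate f (t j k) x)
            = ∏ j ∈ Finset.univ.erase i₀, φ j (zIterate f (t j k) x) :=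
          Finset.prod_congr rfl fun j hj => by simp [Finset.ne_of_mem_erase hj]
        rw [this]
        simp only [Function.update_self, Pi.sub_apply]
        ring
      · exact ((hcomp _ _ hb).mul (.prod _ fun j _ => hcomp _ _ (hφ j))).integrable
      · exact (IsBddMeasurable.prod _ fun j _ => hcomp _ _ (hφ' j)).integrable

end

theorem mem_stableSet_of_mem {X : Type*} [MetricSpace X] {f : X → X} {x y y' : X}
    (hy : y ∈ stableSet f x) (hy' : y' ∈ stableSet f x) : y' ∈ stableSet f y := by
  have := Tendsto.add hy hy'
  rw [add_zero] at this
  refine squeeze_zero (fun _ => dist_nonneg) (fun n => ?_) this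
  rw [dist_comm (f^[n] x) (f^[n] y)]
  exact dist_triangle _ _ _

/-! ### The Hopf argument on a product set -/

section

variable {X : Type*} [MeasurableSpace X] {μ : Measure X} {V : Set X} {mi : Measure X}
  {mj : X → Measure X}

/-- Sets which are null for an iterated integral are null for almost all the inner measures. -/
theorem ae_measure_eq_zero_of_integral [IsFiniteMeasure μ]
    (h : ∀ φ : X → ℝ, Integrable φ μ → (∀ᵐ x ∂mi, Integrable φ (mj x)) ∧
      Integrable (fun x => ∫ y, φ y ∂(mj x)) mi ∧
      ∫ y in V, φ y ∂μ = ∫ x, ∫ y, φ y ∂(mj x) ∂mi)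
    {A : Set X} (hA : MeasurableSet A) (h0 : μ (V ∩ A) = 0) : ∀ᵐ x ∂mi, mj x A = 0 := by
  obtain ⟨h1, h2, h3⟩ := h (A.indicator fun _ => 1) ((integrable_const 1).indicator hA)
  have hzero : ∫ y in V, A.indicator (fun _ => (1 : ℝ)) y ∂μ = 0 := by
    rw [integral_indicator_const _ hA, measureReal_restrict_apply hA, Set.inter_comm,
      measureReal_def, h0]
    simp
  rw [hzero] at h3
  have hae := (integral_eq_zero_iff_of_nonneg (fun x => integral_nonneg fun y =>
    Set.indicator_nonneg (fun _ _ => zero_le_one) y) h2).1 h3.symm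
  filter_upwards [h1, hae] with x hx hx'
  -- Real-valued measure and integral both read infinite mass as zero, so finiteness of `mj x A`
  -- must be known before a zero integral means a null set.
  have hfin : IntegrableOn (fun _ => (1 : ℝ)) A (mj x) := (integrable_indicator_iff hA).1 hx
  have hlt : mj x A < ⊤ := by
    rw [integrableOn_const_iff (by simp)] at hfin
    simpa using hfin
  simp only [integral_indicator_const _ hA, Pi.zero_apply, smul_eq_mul, mul_one] at hx'
  exact (measureReal_eq_zero_iff hlt.ne).1 hx'

theorem measure_inter_eq_zero_of_integral [IsFiniteMeasure μ]
    (h : ∀ φ : X → ℝ, Integrable φ μ → (∀ᵐ x ∂mi, Integrable φ (mj x)) ∧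
      Integrable (fun x => ∫ y, φ y ∂(mj x)) mi ∧
      ∫ y in V, φ y ∂μ = ∫ x, ∫ y, φ y ∂(mj x) ∂mi)
    {A : Set X} (hA : MeasurableSet A) (h0 : ∀ᵐ x ∂mi, mj x A = 0) : μ (V ∩ A) = 0 := by
  obtain ⟨-, -, h3⟩ := h (A.indicator fun _ => 1) ((integrable_const 1).indicator hA)
  have hzero : ∫ x, ∫ y, A.indicator (fun _ => (1 : ℝ)) y ∂(mj x) ∂mi = 0 := by
    rw [← integral_zero X ℝ (μ := mi)]
    refine integral_congr_ae ?_
    filter_upwards [h0] with x hx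
    rw [integral_indicator_const _ hA, measureReal_def, hx]
    simp
  rw [hzero, integral_indicator_const _ hA, measureReal_restrict_apply hA, Set.inter_comm] at h3
  rw [smul_eq_mul, mul_one] at h3
  exact (measureReal_eq_zero_iff (measure_ne_top μ _)).1 h3

end

section

variable {X : Type*} [MetricSpace X] [MeasurableSpace X] {μ : Measure X}

/-- On a product set with absolutely continuous stable partition, functions which are both stably
and unstably invariant are constant. -/
theorem exists_ae_eq_const_on_productSet [IsProbabilityMeasure μ] {f : X ≃ᵐ X} {V : Set X}
    {Ws Wu : X → Set X} {br : X → X → X}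
    (hV : IsProductSet (stableSet f) (unstableSet f) V Ws Wu br)
    (hac : IsAbsolutelyContinuousOn μ V Ws Wu br) (hpos : 0 < μ V) {h : X → ℝ}
    (hm : Measurable h) (hs : IsAEInvariant (fun x y => y ∈ stableSet f x) μ h)
    (hu : IsAEInvariant (fun x y => y ∈ unstableSet f x) μ h) :
    ∃ c : ℝ, ∀ᵐ x ∂μ, x ∈ V → h x = c := by
  obtain ⟨E, hEm, hE, hEs, hEu⟩ : ∃ E : Set X, MeasurableSet E ∧ μ Eᶜ = 0 ∧
      (∀ x ∈ E, ∀ y ∈ E, y ∈ stableSet f x → h x = h y) ∧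
      (∀ x ∈ E, ∀ y ∈ E, y ∈ unstableSet f x → h x = h y) := by
    obtain ⟨E₁, hE₁, hi₁⟩ := hs
    obtain ⟨E₂, hE₂, hi₂⟩ := hu
    have h0 : μ (E₁ ∩ E₂)ᶜ = 0 := by
      have : ∀ᵐ x ∂μ, x ∈ E₁ ∩ E₂ := by filter_upwards [hE₁, hE₂] with x a b using ⟨a, b⟩
      exact this
    have hsub : (toMeasurable μ (E₁ ∩ E₂)ᶜ)ᶜ ⊆ E₁ ∩ E₂ :=
      Set.compl_subset_comm.1 (subset_toMeasurable μ _)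
    refine ⟨(toMeasurable μ (E₁ ∩ E₂)ᶜ)ᶜ, (measurableSet_toMeasurable _ _).compl, ?_, ?_, ?_⟩
    · rw [compl_compl, measure_toMeasurable, h0]
    · exact fun x hx y hy hxy => hi₁ x (hsub hx).1 y (hsub hy).1 hxy
    · exact fun x hx y hy hxy => hi₂ x (hsub hx).2 y (hsub hy).2 hxy
  obtain ⟨mi, mj, hmi, hmj, hhol, hint⟩ := hac
  obtain ⟨hVm, hl, hr, hbr, hbrm⟩ := hV
  have hbr' : ∀ x ∈ V, ∀ y ∈ V, br x y ∈ Ws x ∧ br x y ∈ Wu y := fun x hx y hy => by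
    have : br x y ∈ Ws x ∩ Wu y := by rw [hbr x hx y hy]; rfl
    exact this
  have hbr_eq : ∀ x ∈ V, ∀ y ∈ V, ∀ w, w ∈ Ws x → w ∈ Wu y → w = br x y :=
    fun x hx y hy w h1 h2 => by
      have : w ∈ Ws x ∩ Wu y := ⟨h1, h2⟩
      rwa [hbr x hx y hy] at this
  have hsymm_s : ∀ x ∈ V, ∀ y ∈ V, y ∈ Ws x → x ∈ Ws y := fun x hx y hy hxy => by
    have : x ∈ Ws y ∩ V := by rw [hl.coherent x hx y hy hxy]; exact ⟨hl.mem_self x hx, hx⟩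
    exact this.1
  have hsymm_u : ∀ x ∈ V, ∀ y ∈ V, y ∈ Wu x → x ∈ Wu y := fun x hx y hy hxy => by
    have : x ∈ Wu y ∩ V := by rw [hr.coherent x hx y hy hxy]; exact ⟨hr.mem_self x hx, hx⟩
    exact this.1
  -- the pairs of points of `V` whose bracket is in `V`
  set B : Set (X × X) := {p | p.1 ∈ V ∧ p.2 ∈ V ∧ br p.1 p.2 ∈ V} with hB
  have hBm : MeasurableSet B := by
    have hemb : MeasurableEmbedding (Prod.map (Subtype.val : V → X) (Subtype.val : V → X)) :=
      (MeasurableEmbedding.subtype_coe hVm).prodMap (MeasurableEmbedding.subtype_coe hVm)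
    have := hemb.measurableSet_image.2 (hbrm hVm)
    convert this using 1
    ext ⟨p, q⟩
    constructor
    · rintro ⟨hp, hq, hpq⟩
      exact ⟨(⟨p, hp⟩, ⟨q, hq⟩), hpq, rfl⟩
    · rintro ⟨⟨⟨p', hp⟩, ⟨q', hq⟩⟩, hpq, heq⟩
      obtain ⟨rfl, rfl⟩ := Prod.mk.inj heq
      exact ⟨hp, hq, hpq⟩
  have hsec : ∀ p, MeasurableSet {q | (p, q) ∈ B} := fun p => measurable_prodMk_left hBm
  -- Disintegrate with base leaf `Ws p`: if `x ∈ Ws p ∩ V` and `q ∈ V ∩ Wu x`, then the bracket of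
  -- `p` and `q` is `x` itself, which is in `V`.
  have hbracket : ∀ p ∈ V, μ (V ∩ (V \ {q | (p, q) ∈ B})) = 0 := by
    intro p hp
    refine measure_inter_eq_zero_of_integral (hint p hp) (hVm.diff (hsec p)) ?_
    have hcar : ∀ᵐ x ∂mi p, x ∈ Ws p ∩ V := hmi p hp
    filter_upwards [hcar] with x hx
    refine measure_mono_null ?_ (hmj x hx.2)
    rintro q ⟨hq, hqB⟩ hqx
    refine hqB ⟨hp, hq, ?_⟩
    rw [← hbr_eq p hp q hq x hx.1 (hsymm_u x hx.2 q hq hqx)]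
    exact hx.2
  obtain ⟨z, hz⟩ : V.Nonempty := nonempty_of_measure_ne_zero hpos.ne'
  obtain ⟨h1, h2, -⟩ := hint z hz (fun _ => 1) (integrable_const 1)
  have hgood : ∀ᵐ x ∂mi z, x ∈ V ∧ mj x Set.univ < ⊤ ∧ mj x Eᶜ = 0 ∧ mj x Vᶜ = 0 := by
    have hcar : ∀ᵐ x ∂mi z, x ∈ Ws z ∩ V := hmi z hz
    filter_upwards [hcar, h1,
      ae_measure_eq_zero_of_integral (hint z hz) hEm.compl (measure_mono_null (by simp) hE),
      ae_measure_eq_zero_of_integral (hint z hz) hVm.compl (by simp)] with x a b c d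
    refine ⟨a.2, ?_, c, d⟩
    rw [integrable_const_iff] at b
    simpa [isFiniteMeasure_iff] using b
  obtain ⟨x₀, hx₀ne, hx₀V, hx₀fin, hx₀E, hx₀V'⟩ : ∃ x, mj x Set.univ ≠ 0 ∧ x ∈ V ∧
      mj x Set.univ < ⊤ ∧ mj x Eᶜ = 0 ∧ mj x Vᶜ = 0 := by
    have hnot : ¬ ∀ᵐ x ∂mi z, mj x Set.univ = 0 := fun hcon => by
      have := measure_inter_eq_zero_of_integral (hint z hz) .univ hcon
      rw [Set.inter_univ] at this
      exact hpos.ne' this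
    exact ((not_eventually.1 hnot).and_eventually hgood).exists
  have : IsFiniteMeasure (mj x₀) := ⟨hx₀fin⟩
  have : NeZero (mj x₀) := ⟨fun h => hx₀ne (by simp [h])⟩
  -- for almost all leaves, almost all points of the reference leaf can be moved inside `V`
  have hswap : ∀ᵐ x ∂mi z, mj x Set.univ ≠ 0 → ∀ᵐ p ∂mj x₀, (p, x) ∈ B := by
    set g : X → ℝ := h2.aestronglyMeasurable.mk _ with hg
    have hgm : Measurable g := h2.aestronglyMeasurable.stronglyMeasurable_mk.measurable
    have hgae : ∀ᵐ x ∂mi z, (mj x).real Set.univ = g x := by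
      filter_upwards [h2.aestronglyMeasurable.ae_eq_mk] with x hx
      rw [hg, ← hx]; simp
    have hgpos : ∀ᵐ x ∂mi z, mj x Set.univ ≠ 0 ↔ g x ≠ 0 := by
      filter_upwards [hgae, hgood] with x hx hx'
      rw [← hx, not_iff_not, measureReal_eq_zero_iff hx'.2.1.ne]
    -- Exchanging the two almost-everywhere quantifiers needs σ-finiteness, which `mi z` may lack.
    -- The leaf mass `g` is integrable, so it vanishes almost everywhere off a σ-finite set `T`, and
    -- leaves of zero mass are irrelevant.
    have hgi : AEFinStronglyMeasurable g (mi z) :=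
      (h2.congr h2.aestronglyMeasurable.ae_eq_mk).aefinStronglyMeasurable
    set T := hgi.sigmaFiniteSet
    have hTc : ∀ᵐ x ∂mi z, x ∉ T → g x = 0 :=
      (ae_restrict_iff' hgi.measurableSet.compl).1 hgi.ae_eq_zero_compl
    have hQ : MeasurableSet {q : X × X | g q.2 ≠ 0 → (q.1, q.2) ∈ B} := by
      have h0 : MeasurableSet {q : X × X | g q.2 = 0} :=
        (hgm.comp measurable_snd) (measurableSet_singleton 0)
      convert h0.union hBm using 1
      ext q
      simp only [Set.mem_union, Set.mem_ofPred_eq]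
      exact or_iff_not_imp_left.symm
    have hall : ∀ᵐ p ∂mj x₀, ∀ᵐ x ∂(mi z).restrict T, g x ≠ 0 → (p, x) ∈ B := by
      have hVae : ∀ᵐ p ∂mj x₀, p ∈ V := hx₀V'
      filter_upwards [hVae] with p hp
      refine ae_restrict_of_ae ?_
      filter_upwards [hgpos, hgood, ae_measure_eq_zero_of_integral (hint z hz)
        (hVm.diff (hsec p)) (hbracket p hp)] with x hx ⟨hxV, _, _, hxV'⟩ hxB hgx
      have hne := hx.2 hgx
      -- The bracket with `p` depends only on the unstable leaf, so one point `q` of the leaf of `x`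
      -- with bracket in `V` settles the matter for `x`.
      obtain ⟨q, hq⟩ : ((V \ {q | (p, q) ∈ B}) ∪ Vᶜ ∪ (Wu x)ᶜ)ᶜ.Nonempty := by
        rw [Set.nonempty_compl]
        intro hcon
        apply hne
        rw [← hcon]
        exact measure_union_null (measure_union_null hxB hxV') (hmj x hxV)
      simp only [Set.compl_union, compl_compl, Set.mem_inter_iff, Set.mem_compl_iff,
        Set.mem_sdiff, not_and, not_not] at hq
      obtain ⟨⟨hqB, hqV⟩, hqx⟩ := hq
      have hqB := hqB hqV
      have hin : br p q ∈ Wu x ∩ V := by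
        rw [← hr.coherent x hxV q hqV hqx]
        exact ⟨(hbr' p hp q hqV).2, hqB.2.2⟩
      refine ⟨hp, hxV, ?_⟩
      change br p x ∈ V
      rw [← hbr_eq p hp x hxV (br p q) (hbr' p hp q hqV).1 hin.1]
      exact hin.2
    have hall' := (Measure.ae_ae_comm (p := fun p x => g x ≠ 0 → (p, x) ∈ B) hQ).1 hall
    rw [ae_restrict_iff' hgi.measurableSet] at hall'
    filter_upwards [hall', hTc, hgpos] with x a b c hx
    have hgx := c.1 hx
    filter_upwards [a (by by_contra hxT; exact hgx (b hxT))] with p hp using hp hgx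
  have hE₀ : ∀ᵐ p ∂mj x₀, p ∈ E := hx₀E
  have hW₀ : ∀ᵐ p ∂mj x₀, p ∈ Wu x₀ := hmj x₀ hx₀V
  obtain ⟨p₀, hp₀E, hp₀W⟩ := (hE₀.and hW₀).exists
  refine ⟨h p₀, ?_⟩
  have hneq : MeasurableSet {x | h x ≠ h p₀} := hm (measurableSet_singleton (h p₀)).compl
  have hnull : μ (V ∩ {x | h x ≠ h p₀}) = 0 := by
    refine measure_inter_eq_zero_of_integral (hint z hz) hneq ?_
    filter_upwards [hgood, hswap] with x ⟨hxV, _, hxE, _⟩ hx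
    by_cases hx0 : mj x Set.univ = 0
    · exact measure_mono_null (Set.subset_univ _) hx0
    -- Holonomy carries the bad points of the leaf of `x` to a null set of the reference leaf. A
    -- good `p` outside this set therefore has its partner `q` on the leaf of `x` in `E`, and `h`
    -- agrees along `p₀`, `p`, `q` and almost all of the leaf of `x`.
    have hN : mj x₀ ((fun n => br n x₀) '' (Wu x ∩ V ∩ Eᶜ)) = 0 :=
      hhol x hxV x₀ hx₀V _ Set.inter_subset_left (measure_mono_null Set.inter_subset_right hxE)
    have hN' : ∀ᵐ p ∂mj x₀, p ∉ (fun n => br n x₀) '' (Wu x ∩ V ∩ Eᶜ) :=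
      measure_eq_zero_iff_ae_notMem.1 hN
    obtain ⟨p, hpE, hpW, ⟨hpV, -, hqV⟩, hpN⟩ := (hE₀.and (hW₀.and ((hx hx0).and hN'))).exists
    change p ∈ V at hpV
    change br p x ∈ V at hqV
    obtain ⟨hqs, hqu⟩ := hbr' p hpV x hxV
    set q := br p x
    have hpq : p = br q x₀ := hbr_eq q hqV x₀ hx₀V p (hsymm_s p hpV q hqV hqs) hpW
    have hqE : q ∈ E := by
      by_contra hqE
      exact hpN ⟨q, ⟨⟨hqu, hqV⟩, hqE⟩, hpq.symm⟩
    have hqc : h q = h p₀ := by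
      rw [← hEs p hpE q hqE (hl.subset p hpV hqs)]
      exact (hEu p₀ hp₀E p hpE
        (mem_stableSet_of_mem (hr.subset x₀ hx₀V hp₀W) (hr.subset x₀ hx₀V hpW))).symm
    refine measure_mono_null ?_ (measure_union_null hxE (hmj x hxV))
    intro w hw
    by_contra hcon
    simp only [Set.mem_union, Set.mem_compl_iff, not_or, not_not] at hcon
    refine hw ?_
    rw [← hqc]
    exact hEu w hcon.1 q hqE
      (mem_stableSet_of_mem (hr.subset x hxV hcon.2) (hr.subset x hxV hqu))
  filter_upwards [measure_eq_zero_iff_ae_notMem.1 hnull] with x hx hxV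
  by_contra hne
  exact hx ⟨hxV, hne⟩

/-- For a totally ergodic map with an absolutely continuous product set of positive measure, the
functions which are both stably and unstably invariant are constant. -/
theorem exists_ae_eq_const [IsProbabilityMeasure μ] {f : X ≃ᵐ X} (hf : MeasurePreserving f μ μ)
    (herg : IsTotallyErgodic f μ) {V : Set X} {Ws Wu : X → Set X} {br : X → X → X}
    (hV : IsProductSet (stableSet f) (unstableSet f) V Ws Wu br)
    (hac : IsAbsolutelyContinuousOn μ V Ws Wu br) (hpos : 0 < μ V) {h : X → ℝ}
    (hm : Measurable h) (hs : IsAEInvariant (fun x y => y ∈ stableSet f x) μ h)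
    (hu : IsAEInvariant (fun x y => y ∈ unstableSet f x) μ h) :
    ∃ c : ℝ, ∀ᵐ x ∂μ, h x = c := by
  have hVm := hV.measurableSet
  have hcompm : ∀ {k : X → ℝ} (t : ℤ), Measurable k → Measurable fun x => k (zIterate f t x) :=
    fun t hk => hk.comp (measurePreserving_zIterate hf t).measurable
  have hpull : ∀ (t : ℤ) {P : X → Prop}, (∀ᵐ x ∂μ, P x) → ∀ᵐ x ∂μ, P (zIterate f t x) :=
    fun t P hP => (measurePreserving_zIterate hf t).quasiMeasurePreserving.ae hP
  -- Poincaré recurrence. The time `p` depends on `V` alone, so it serves all the functions `h ∘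
  -- f^{-n}` below.
  obtain ⟨p, hp, hVp⟩ := hf.conservative.exists_gt_measure_inter_ne_zero
    hVm.nullMeasurableSet hpos.ne' 0
  have hreturn : ∀ k : X → ℝ, Measurable k → IsAEInvariant (fun x y => y ∈ stableSet f x) μ k →
      IsAEInvariant (fun x y => y ∈ unstableSet f x) μ k →
      ∀ᵐ x ∂μ, x ∈ V → k (zIterate f p x) = k x := by
    intro k hk hks hku
    obtain ⟨c, hc⟩ := exists_ae_eq_const_on_productSet hV hac hpos hk hks hku
    obtain ⟨c', hc'⟩ := exists_ae_eq_const_on_productSet hV hac hpos (hcompm p hk)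
      (hks.comp_zIterate hf (zIterate_mem_stableSet f) p)
      (hku.comp_zIterate hf (zIterate_mem_unstableSet f) p)
    have hfreq : ∃ᵐ x ∂μ, x ∈ V ∩ f^[p] ⁻¹' V := frequently_ae_mem_iff.2 hVp
    obtain ⟨x, ⟨hxV, hxp⟩, h1, h2⟩ := (hfreq.and_eventually ((hpull p hc).and hc')).exists
    -- The constant values on `V` of `k` and of `k ∘ f^p` are compared at a point of `V` that
    -- returns to `V` at time `p`.
    have hcc : c' = c := by
      rw [← h1 (by rw [zIterate_natCast]; exact hxp), h2 hxV]
    filter_upwards [hc, hc'] with y hy hy' hyV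
    rw [hy' hyV, hy hyV, hcc]
  have hvisit : ∀ᵐ x ∂μ, ∃ n : ℕ, zIterate f n x ∈ V := by
    have hUm : MeasurableSet (⋃ n : ℕ, zIterate f n ⁻¹' V) :=
      .iUnion fun n => (measurePreserving_zIterate hf n).measurable hVm
    have hf1 : Ergodic f μ := by simpa using herg 1 le_rfl
    rcases hf1.ae_empty_or_univ_of_preimage_ae_le hUm.nullMeasurableSet (by
      refine LE.le.eventuallyLE ?_
      rintro x hx
      simp only [Set.preimage_iUnion, Set.mem_iUnion, Set.mem_preimage] at hx ⊢
      obtain ⟨n, hn⟩ := hx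
      refine ⟨n + 1, ?_⟩
      rw [zIterate_natCast] at hn ⊢
      exact hn) with h0 | h1
    · exfalso
      refine hpos.ne' (measure_mono_null ?_ (ae_eq_empty.1 h0))
      intro x hx
      simp only [Set.mem_iUnion, Set.mem_preimage]
      exact ⟨0, by simpa [zIterate_zero] using hx⟩
    · filter_upwards [eventuallyEq_univ.1 h1] with x hx
      simpa using hx
  have hinv : ∀ᵐ x ∂μ, h (zIterate f p x) = h x := by
    have hall : ∀ᵐ x ∂μ, ∀ n : ℕ, zIterate f n x ∈ V → h (zIterate f p x) = h x := by
      refine ae_all_iff.2 fun n => ?_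
      -- Applying the return identity to `h ∘ f^{-n}` at the point `f^n x ∈ V` gives `h (f^p x) = h
      -- x`.
      have h1 := hpull n (hreturn (fun x => h (zIterate f (-n) x)) (hcompm _ hm)
        (hs.comp_zIterate hf (zIterate_mem_stableSet f) _)
        (hu.comp_zIterate hf (zIterate_mem_unstableSet f) _))
      filter_upwards [h1] with x hx hxn
      have := hx hxn
      simp only [← zIterate_add] at this
      rwa [show (-n + (p + n) : ℤ) = p by ring, neg_add_cancel, zIterate_zero] at this
    filter_upwards [hall, hvisit] with x hx ⟨n, hn⟩ using hx n hn
  have hinv' : h ∘ f^[p] =ᵐ[μ] h := by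
    rw [← zIterate_natCast]
    exact hinv
  exact (herg p hp).ae_eq_const_of_ae_eq_comp_ae hm.aestronglyMeasurable hinv'

end

/-! ### From correlations to multiple mixing -/

theorem exists_isBddMeasurable_ae_eq {X : Type*} [MeasurableSpace X] {μ : Measure X} {φ : X → ℝ}
    (hφ : MemLp φ ⊤ μ) : ∃ φ' : X → ℝ, IsBddMeasurable φ' ∧ φ =ᵐ[μ] φ' := by
  obtain ⟨C, hC⟩ : ∃ C : ℝ, ∀ᵐ x ∂μ, |φ x| ≤ C := by
    refine ⟨(eLpNorm φ ⊤ μ).toReal, ?_⟩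
    filter_upwards [ae_le_eLpNormEssSup (f := φ) (μ := μ)] with x hx
    rw [← eLpNorm_exponent_top] at hx
    have := ENNReal.toReal_mono hφ.2.ne hx
    simpa using this
  set ψ := hφ.1.mk φ
  refine ⟨fun x => max (-|C|) (min |C| (ψ x)), ⟨measurable_const.max
    (measurable_const.min hφ.1.stronglyMeasurable_mk.measurable), |C|, fun x => ?_⟩, ?_⟩
  · rw [abs_le]
    exact ⟨le_max_left _ _, max_le (by linarith [abs_nonneg C]) (min_le_left _ _)⟩
  · filter_upwards [hC, hφ.1.ae_eq_mk] with x hx hx'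
    have := abs_le.1 (hx.trans (le_abs_self C))
    rw [hx'] at this
    rw [min_eq_right this.2, max_eq_right this.1, hx']

/-- The times are `0` followed by the partial sums of the gaps; the extra time `0` is for the test
function. Any later time exceeds an earlier one by at least its own last gap `n j`. -/
theorem tendsto_cons_sum_sub {N : ℕ} (i j : Fin (N + 1)) (hij : i < j) :
    Tendsto (fun n : Fin N → ℕ =>
      (Fin.cons 0 (fun i => ((∑ l ∈ Finset.Iic i, n l : ℕ) : ℤ)) : Fin (N + 1) → ℤ) j -
      (Fin.cons 0 (fun i => ((∑ l ∈ Finset.Iic i, n l : ℕ) : ℤ)) : Fin (N + 1) → ℤ) i)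
      atTop atTop := by
  obtain ⟨j, rfl⟩ := Fin.exists_succ_eq_of_ne_zero (Fin.ne_zero_of_lt hij)
  have hj : Tendsto (fun n : Fin N → ℕ => ((n j : ℕ) : ℤ)) atTop atTop :=
    tendsto_natCast_atTop_atTop.comp (tendsto_atTop.2 fun b =>
      (eventually_ge_atTop (fun _ => b)).mono fun n hn => hn j)
  refine tendsto_atTop_mono (fun n => ?_) hj
  induction i using Fin.cases with
  | zero =>
    simp only [Fin.cons_succ, Fin.cons_zero, sub_zero, Nat.cast_le]
    exact Finset.single_le_sum (f := n) (fun _ _ => Nat.zero_le _) (Finset.mem_Iic.2 le_rfl)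
  | succ i =>
    have hij' : i < j := Fin.succ_lt_succ_iff.1 hij
    simp only [Fin.cons_succ]
    have h1 : n j + ∑ l ∈ Finset.Iic i, n l ≤ ∑ l ∈ Finset.Iic j, n l := by
      rw [← Finset.sum_insert (by simpa using hij')]
      refine Finset.sum_le_sum_of_subset fun l hl => ?_
      rw [Finset.mem_insert, Finset.mem_Iic] at hl
      rw [Finset.mem_Iic]
      rcases hl with rfl | hl
      · exact le_rfl
      · exact hl.trans hij'.le
    have h2 : ((n j + ∑ l ∈ Finset.Iic i, n l : ℕ) : ℤ) ≤ ((∑ l ∈ Finset.Iic j, n l : ℕ) : ℤ) :=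
      Nat.cast_le.2 h1
    push_cast at h2 ⊢
    linarith

/-- If all functions which are both stably and unstably invariant are constant, then `f` is
multiply mixing. -/
theorem isMultiplyMixing_of_invariant_const {X : Type*} [MetricSpace X] [MeasurableSpace X]
    [BorelSpace X] {μ : Measure X} [IsProbabilityMeasure μ] {f : X ≃ᵐ X}
    (hf : MeasurePreserving f μ μ)
    (htriv : ∀ h : X → ℝ, Measurable h → IsAEInvariant (fun x y => y ∈ stableSet f x) μ h →
      IsAEInvariant (fun x y => y ∈ unstableSet f x) μ h → ∃ c : ℝ, ∀ᵐ x ∂μ, h x = c) :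
    IsMultiplyMixing f μ := by
  intro N φ hφ ψ hψ
  choose φ' hφ' hφφ' using fun i => exists_isBddMeasurable_ae_eq (hφ i)
  set P : (Fin N → ℕ) → X → ℝ := fun n x => ∏ i, φ' i (f^[∑ j ∈ Finset.Iic i, n j] x) with hP
  set c : ℝ := ∏ i, ∫ t, φ' i t ∂μ with hc
  have hPb : ∀ n, IsBddMeasurable (P n) := fun n =>
    .prod _ fun i _ => (hφ' i).comp (hf.iterate _).measurable
  set g : (Fin N → ℕ) → X → ℝ := fun n => P n - fun _ => c with hg
  have hgm : ∀ n, Measurable (g n) := fun n => (hPb n).1.sub measurable_const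
  have hgC : ∃ C, ∀ n x, |g n x| ≤ C := by
    choose D hD using fun i => (hφ' i).2
    refine ⟨∏ i, D i + |c|, fun n x => (abs_sub _ _).trans (add_le_add ?_ le_rfl)⟩
    rw [hP, Finset.abs_prod]
    exact Finset.prod_le_prod (fun _ _ => abs_nonneg _) fun i _ => hD i _
  have hbdd : ∀ b : X → ℝ, IsBddMeasurable b →
      Tendsto (fun n => ∫ x, b x * g n x ∂μ) atTop (𝓝 0) := by
    intro b hb
    have h1 := tendsto_integral_prod_zIterate (l := (atTop : Filter (Fin N → ℕ))) hf htriv (N + 1)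
      (Fin.cons b φ') (fun i => by
        induction i using Fin.cases with
        | zero => exact hb
        | succ i => exact hφ' i)
      (fun i n => (Fin.cons 0 (fun i => ((∑ l ∈ Finset.Iic i, n l : ℕ) : ℤ)) :
        Fin (N + 1) → ℤ) i) tendsto_cons_sum_sub
    simp only [Fin.prod_univ_succ, Fin.cons_zero, Fin.cons_succ, zIterate_zero,
      zIterate_natCast] at h1
    have h2 := h1.sub_const ((∫ x, b x ∂μ) * c)
    rw [sub_self] at h2
    refine h2.congr fun n => ?_
    rw [← integral_mul_const, ← integral_sub (hb.mul (hPb n)).integrable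
      (hb.integrable.mul_const c)]
    congr 1 with x
    simp only [hg, hP, Pi.sub_apply]; ring
  -- Only bounded test functions can enter the correlations as an extra factor; an `L²` test
  -- function is reached by density, the weakly null ones forming a closed subspace.
  have hmem : hψ.toLp ψ ∈ weakNullSubmodule (μ := μ) atTop g hgm hgC := by
    refine isClosed_weakNullSubmodule.closure_subset (Metric.mem_closure_iff.2 fun ε hε => ?_)
    obtain ⟨b, hb, hbu, hbC⟩ := exists_uniformContinuous_eLpNorm_sub_le hψ
      (ε := ENNReal.ofReal (ε / 2)) (by simpa using hε)
    have hbb : IsBddMeasurable b := ⟨hbu.continuous.measurable, hbC⟩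
    have hb2 : MemLp b 2 μ := hbb.memLp
    refine ⟨hb2.toLp b, ?_, ?_⟩
    · rw [SetLike.mem_coe, mem_weakNullSubmodule]
      simpa only [integral_toLp_mul] using hbdd b hbb
    · rw [dist_eq_norm, ← MemLp.toLp_sub, Lp.norm_toLp]
      have := ENNReal.toReal_le_of_le_ofReal (by positivity) hb
      linarith
  rw [mem_weakNullSubmodule] at hmem
  simp only [integral_toLp_mul] at hmem
  have hcφ : ∏ i, ∫ t, φ i t ∂μ = c :=
    Finset.prod_congr rfl fun i _ => integral_congr_ae (hφφ' i)
  have h3 := hmem.add_const (∫ x, c * ψ x ∂μ)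
  rw [zero_add] at h3
  simp only [hcφ]
  refine h3.congr fun n => ?_
  have hψi : Integrable ψ μ := hψ.integrable one_le_two
  obtain ⟨C, hC⟩ := hgC
  have hgi : Integrable (fun x => ψ x * g n x) μ :=
    MemLp.integrable_mul (p := 2) (q := 2) hψ (memLp_of_bound (hgm n) (hC n))
  rw [← integral_add hgi (hψi.const_mul c)]
  have hae : ∀ᵐ x ∂μ, ∀ i, φ i (f^[∑ j ∈ Finset.Iic i, n j] x)
      = φ' i (f^[∑ j ∈ Finset.Iic i, n j] x) :=
    ae_all_iff.2 fun i => (hf.iterate _).quasiMeasurePreserving.ae (hφφ' i)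
  refine integral_congr_ae ?_
  filter_upwards [hae] with x hx
  rw [Finset.prod_congr rfl fun i _ => hx i]
  simp only [hg, hP, Pi.sub_apply]; ring

end HopfMixing

theorem mainTheorem6 {X : Type*} [MetricSpace X] [MeasurableSpace X] [BorelSpace X]
    (μ : Measure X) [IsProbabilityMeasure μ]
    (f : X ≃ᵐ X) (hf : MeasurePreserving f μ μ)
    (herg : HopfMixing.IsTotallyErgodic f μ)
    (V : Set X) (Ws Wu : X → Set X) (br : X → X → X)
    (hV : HopfMixing.IsProductSet (HopfMixing.stableSet f) (HopfMixing.unstableSet f) V Ws Wu br)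
    (hac : HopfMixing.IsAbsolutelyContinuousOn μ V Ws Wu br)
    (hpos : 0 < μ V) :
    HopfMixing.IsMultiplyMixing f μ :=
  HopfMixing.isMultiplyMixing_of_invariant_const hf fun _ hm hs hu =>
    HopfMixing.exists_ae_eq_const hf herg hV hac hpos hm hs hu
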